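/- **Model.** Let $\mu$ be a probability measure on $[0,\infty)$ with $\mu([0,1])=1$ and $\mu\neq\delta_0$, let $\Omega=[0,\infty)^{\mathbb Z}$ with elements $\omega=(\omega_k)_{k\in\mathbb Z}$, and let $\mathbb P=\bigotimes_{k\in\mathbb Z}\mu$, so that the $\omega_k$ are independent with distribution $\mu$; put $\mathbb E\{\omega_k\}=\int x\,d\mu(x)$. Let $l\ge 1$ and let $g\in C_0^2(0,l)$ (twice continuously differentiable with compact support in $(0,l)$, extended by zero to $\mathbb R$) satisfy $$\max\{\|g\|_{C[0,l]},\|g'\|_{C[0,l]},\|g''\|_{C[0,l]}\}=1.$$ Put $G(x_1,\omega)=\sum_{k\in\mathbb Z}\omega_k\,g(x_1-kl)$. For $\kappa>0$ and $N\in\mathbb N$ let $$D_{\kappa,\omega}(N)=\{x\in\mathbb R^2 : 0<x_1<Nl,\ \kappa G(x_1,\omega)<x_2<\kappa G(x_1,\omega)+\pi\},$$ and let $\lambda_{\kappa,\omega}(N)$ be the lowest eigenvalue of the negative Laplace operator on $D_{\kappa,\omega}(N)$ with Dirichlet boundary conditions on the upper and lower parts $\{0<x_1<Nl,\ x_2=\kappa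 G(x_1,\omega)\}$ and $\{0<x_1<Nl,\ x_2=\kappa G(x_1,\omega)+\pi\}$ of the boundary and Neumann boundary conditions on the rest of the boundary. Put $$\widetilde g=g-\frac1l\int_0^l g(t)\,dt,\qquad c_2=\frac{3\,\|\widetilde g\|_{L_2(0,l)}^2}{2\,l^3},\qquad c_3=\frac{3\,\|\widetilde g\|_{L_2(0,l)}^2}{5000\,l^7}.$$ **Theorem.** There is a constant $c_4>0$ depending only on $\mu$ such that the following holds for all $l$ and $g$ as above and every real $\gamma>34$. There is an initial scale $N_1$ (which may depend on $\mu,l,g,\gamma$) such that for every integer $N\ge N_1$ the interval $$I_N=\left[\frac{2\,N^{\frac1\gamma-\frac14}}{\mathbb E\{\omega_k\}\sqrt{c_2}},\ c_3\,N^{-\frac{15}{2\gamma}}\right]$$ is non-empty, and for every $\kappa\in I_N$ $$\mathbb P\left(\omega\in\Omega : \lambda_{\kappa,\omega}(N)-1\le N^{-\frac12}\right)\le N^{1-\frac1\gamma}\,e^{-c_4N^{1/\gamma}}.$$ -/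

import Mathlib

open MeasureTheory
open scoped NNReal

namespace Waveguide

noncomputable section

/-- The configuration space `Ω`: sequences `(ω_k)_{k ∈ ℤ}` of non-negative reals. -/
abbrev Config : Type := ℤ → ℝ≥0

/-- The shape function `G(x₁, ω) = ∑_{k ∈ ℤ} ω_k g(x₁ - k l)`.  For `g` supported in `(0, l)` at most
one summand is nonzero at each point. -/
def shape (l : ℝ) (g : ℝ → ℝ) (ω : Config) (x : ℝ) : ℝ :=
  ∑' k : ℤ, (ω k : ℝ) * g (x - (k : ℝ) * l)

/-- The finite waveguide segment `D_{κ,ω}(N,j)`. -/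
def segment (l : ℝ) (g : ℝ → ℝ) (κ : ℝ) (ω : Config) (N : ℕ) (j : ℤ) : Set (ℝ × ℝ) :=
  {x | (j : ℝ) * l < x.1 ∧ x.1 < ((j : ℝ) + (N : ℝ)) * l ∧
    κ * shape l g ω x.1 < x.2 ∧ x.2 < κ * shape l g ω x.1 + Real.pi}

/-- The lower and upper part `Γ_{κ,ω}(N,j)` of the boundary of the segment. -/
def wall (l : ℝ) (g : ℝ → ℝ) (κ : ℝ) (ω : Config) (N : ℕ) (j : ℤ) : Set (ℝ × ℝ) :=
  {x | (j : ℝ) * l < x.1 ∧ x.1 < ((j : ℝ) + (N : ℝ)) * l ∧ x.2 = κ * shape l g ω x.1} ∪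
  {x | (j : ℝ) * l < x.1 ∧ x.1 < ((j : ℝ) + (N : ℝ)) * l ∧ x.2 = κ * shape l g ω x.1 + Real.pi}

/-- The real Hilbert space `L₂(D)` of a planar domain `D`. -/
abbrev L2 (D : Set (ℝ × ℝ)) : Type := Lp ℝ 2 (volume.restrict D)

/-- Triples `(φ, ∂₁φ, ∂₂φ)` in `L₂(D)³`, where `φ` is (the restriction to `D` of) a smooth function on
the plane that vanishes in a neighbourhood of the closure of `Γ`. -/
def smoothTriples (D Γ : Set (ℝ × ℝ)) : Set (L2 D × L2 D × L2 D) :=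
  {p | ∃ φ : ℝ × ℝ → ℝ, ContDiff ℝ ((⊤ : ℕ∞) : WithTop ℕ∞) φ ∧ Disjoint (tsupport φ) (closure Γ) ∧
    p.1 =ᵐ[volume.restrict D] φ ∧
    p.2.1 =ᵐ[volume.restrict D] (fun x => fderiv ℝ φ x (1, 0)) ∧
    p.2.2 =ᵐ[volume.restrict D] (fun x => fderiv ℝ φ x (0, 1))}

/-- The Sobolev space of `H¹(D)`-functions that vanish on `Γ`, each function listed with its weak
gradient as a triple `(u, ∂₁u, ∂₂u)`.  It is the closure, in the `H¹` norm, of the smooth functions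
that vanish near `Γ`, and is the domain of the quadratic form of the Laplacian with Dirichlet
conditions on `Γ` and Neumann conditions on the rest of the boundary. -/
def formDomain (D Γ : Set (ℝ × ℝ)) : Set (L2 D × L2 D × L2 D) :=
  closure (smoothTriples D Γ)

/-- The graph of the negative Laplace operator `H` on `D` with Dirichlet conditions on `Γ` and Neumann
conditions on `∂D \ Γ`, the self-adjoint operator of the closed form `∫_D ∇u · ∇v`:
`u` lies in the domain of `H` and `H u = f`. -/
def IsNegLaplacian (D Γ : Set (ℝ × ℝ)) (u f : L2 D) : Prop :=
  ∃ w₁ w₂ : L2 D, (u, w₁, w₂) ∈ formDomain D Γ ∧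
    ∀ v z₁ z₂ : L2 D, (v, z₁, z₂) ∈ formDomain D Γ →
      inner ℝ w₁ z₁ + inner ℝ w₂ z₂ = inner ℝ f v

/-- `E` is an eigenvalue of the negative Laplacian on `D` (Dirichlet on `Γ`, Neumann elsewhere). -/
def IsEigenvalue (D Γ : Set (ℝ × ℝ)) (E : ℝ) : Prop :=
  ∃ u : L2 D, u ≠ 0 ∧ IsNegLaplacian D Γ u (E • u)

/-- The lowest eigenvalue `λ_{κ,ω}(N,j)` of `H_{κ,ω}(N,j)`. -/
def lowestEigenvalue (l : ℝ) (g : ℝ → ℝ) (κ : ℝ) (ω : Config) (N : ℕ) (j : ℤ) : ℝ :=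
  sInf {E | IsEigenvalue (segment l g κ ω N j) (wall l g κ ω N j) E}

/-- The norm of `C[0,l]`. -/
def supNorm (l : ℝ) (f : ℝ → ℝ) : ℝ := sSup ((fun x => |f x|) '' Set.Icc 0 l)

/-- Admissible single bump functions: `g ∈ C₀²(0,l)`, extended by zero to the line, normalized by
`max {‖g‖, ‖g'‖, ‖g''‖} = 1` in the norm of `C[0,l]`. -/
structure IsBump (l : ℝ) (g : ℝ → ℝ) : Prop where
  contDiff : ContDiff ℝ 2 g
  tsupport_subset : tsupport g ⊆ Set.Ioo 0 l
  normalized : max (supNorm l g) (max (supNorm l (deriv g)) (supNorm l (deriv (deriv g)))) = 1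

/-- Admissible single-site distributions: laws on `[0,∞)` that live on `[0,1]` and are
not concentrated at zero. -/
structure IsSiteLaw (μ : Measure ℝ≥0) : Prop where
  bounded : ∀ᵐ x ∂μ, x ≤ 1
  nontrivial : μ ≠ Measure.dirac 0

/-- The expectation of a single `ω_k` with distribution `μ`. -/
def mean (μ : Measure ℝ≥0) : ℝ := ∫ x, (x : ℝ) ∂μ

/-- `g` minus its mean value over `(0,l)`. -/
def centered (l : ℝ) (g : ℝ → ℝ) (x : ℝ) : ℝ := g x - (1 / l) * ∫ t in (0 : ℝ)..l, g t

/-- The `L₂(0,l)` norm of the centered bump function. -/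
def centeredNorm (l : ℝ) (g : ℝ → ℝ) : ℝ := Real.sqrt (∫ x in (0 : ℝ)..l, centered l g x ^ 2)

def c₂ (l : ℝ) (g : ℝ → ℝ) : ℝ := 3 * centeredNorm l g ^ 2 / (2 * l ^ 3)

def c₃ (l : ℝ) (g : ℝ → ℝ) : ℝ := 3 * centeredNorm l g ^ 2 / (5000 * l ^ 7)

/-- The interval `I_N` of coupling constants. -/
def couplingInterval (μ : Measure ℝ≥0) (l : ℝ) (g : ℝ → ℝ) (γ : ℝ) (N : ℕ) : Set ℝ :=
  Set.Icc (2 * (N : ℝ) ^ (1 / γ - 1 / 4) / (mean μ * Real.sqrt (c₂ l g)))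
    (c₃ l g * (N : ℝ) ^ (-(15 / (2 * γ))))

end

end Waveguide

/-!
The walls of the waveguide are two copies of the graph of `G`, and the shear `(x, y) ↦ (x, y + G x)`
straightens it to the rectangle `(0, Nl) × (0, π)`, where `∂₁` becomes `P = ∂ₓ - τ ∂ᵧ` with `τ = G'`
(here `G` includes the coupling constant `κ`).
The threshold `1` is the lowest Dirichlet eigenvalue of the fibre `(0, π)`, with ground state `sin`.
The excess of a function `F` over a fibre is `e = ∫ P² + ∫ ((∂ᵧF)² - F²)`, and the claim is that the
total mass `∫∫ F²` is smaller than `N ^ (1 / 2)` times the total excess.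

*Bending costs energy.*  Let `a = ∫ F sin` and `b = ∫ F cos` over the fibre.  By the spectral gap of
the fibre (`dirichlet_gap`), `b` and the part of `F` orthogonal to `sin` are `O(√e)`.  Integration by
parts in `y` gives the exact rotation equations `a' = ∫ P sin - τ b` and `b' = ∫ P cos + τ a`
(`fibre_estimates`).  So `a' = O(√e)`, and in a cell, where `τ = t g'`, testing the second equation
with `g'` bounds `t ∫ g'² a` by `∫ √e` (`cell_mean_bound`).  Summing over the cells of a block and using
that `a` varies slowly gives a pointwise bound on `a`, hence a bound of the mass of the block by its
excess, with a constant governed by `∑ t` (`block_mass_le`).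

*Probability.*  Cut the `N` cells into at most `N ^ (1 - 1 / γ)` blocks of at least
`K = ⌈N ^ (1 / γ)⌉` cells.  By Hoeffding's inequality, `∑ ω` over `K` sites is at least half its
expectation outside an event of probability `exp (-c K)`.  When no block is bad,
`le_lowestEigenvalue` applies, and `eventually_gap` checks that the resulting gap exceeds
`N ^ (-1 / 2)` for all `κ` in the coupling interval.

*Existence of an eigenvalue.*  The lowest eigenvalue is an infimum, which would be `0` if there were
no eigenvalues, so the existence of one has to be shown.  The Rayleigh quotient is minimized
(`exists_minimizer`); the compactness needed comes from Poincaré inequalities on a fine grid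
(`grid_estimate`).
-/

namespace Waveguide

/-! ### Inequalities on intervals -/

/-- Lagrange's identity for integrals over an interval. -/
theorem integral_integral_cross_sq {f s : ℝ → ℝ} (hf : Continuous f) (hs : Continuous s) (a b : ℝ) :
    ∫ x in a..b, ∫ y in a..b, (f x * s y - f y * s x) ^ 2 =
      2 * ((∫ x in a..b, f x ^ 2) * (∫ x in a..b, s x ^ 2) - (∫ x in a..b, f x * s x) ^ 2) := by
  have inner : ∀ x, ∫ y in a..b, (f x * s y - f y * s x) ^ 2 =
      f x ^ 2 * (∫ y in a..b, s y ^ 2) - 2 * (f x * s x) * (∫ y in a..b, f y * s y)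
        + s x ^ 2 * ∫ y in a..b, f y ^ 2 := by
    intro x
    rw [← intervalIntegral.integral_const_mul, ← intervalIntegral.integral_const_mul,
      ← intervalIntegral.integral_const_mul, ← intervalIntegral.integral_sub,
      ← intervalIntegral.integral_add]
    · exact intervalIntegral.integral_congr fun y _ => by ring
    all_goals exact Continuous.intervalIntegrable (by fun_prop) _ _
  simp_rw [inner]
  rw [intervalIntegral.integral_add, intervalIntegral.integral_sub,
    intervalIntegral.integral_mul_const, intervalIntegral.integral_mul_const,
    intervalIntegral.integral_mul_const, intervalIntegral.integral_const_mul]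
  · ring
  all_goals exact Continuous.intervalIntegrable (by fun_prop) _ _

theorem sq_integral_mul_le {f s : ℝ → ℝ} (hf : Continuous f) (hs : Continuous s) {a b : ℝ}
    (hab : a ≤ b) :
    (∫ x in a..b, f x * s x) ^ 2 ≤ (∫ x in a..b, f x ^ 2) * ∫ x in a..b, s x ^ 2 := by
  have h := integral_integral_cross_sq hf hs a b
  have : 0 ≤ ∫ x in a..b, ∫ y in a..b, (f x * s y - f y * s x) ^ 2 :=
    intervalIntegral.integral_nonneg hab fun x _ =>
      intervalIntegral.integral_nonneg hab fun y _ => sq_nonneg _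
  linarith

theorem sq_integral_le {f : ℝ → ℝ} (hf : Continuous f) {a b : ℝ} (hab : a ≤ b) :
    (∫ x in a..b, f x) ^ 2 ≤ (b - a) * ∫ x in a..b, f x ^ 2 := by
  have h := sq_integral_mul_le hf (continuous_const (y := (1 : ℝ))) hab
  simp only [mul_one, one_pow, intervalIntegral.integral_const, smul_eq_mul] at h
  linarith

/-- A uniform bound on the cross terms bounds the Gram determinant of `f` and `s`, that is, the
distance of `f` from the multiples of `s`. -/
theorem gram_le_of_cross_sq_le {f s : ℝ → ℝ} (hf : Continuous f) (hs : Continuous s) {a b M : ℝ}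
    (hab : a ≤ b)
    (h : ∀ x ∈ Set.Icc a b, ∀ y ∈ Set.Icc a b, (f x * s y - f y * s x) ^ 2 ≤ M) :
    2 * ((∫ x in a..b, f x ^ 2) * (∫ x in a..b, s x ^ 2) - (∫ x in a..b, f x * s x) ^ 2) ≤
      (b - a) ^ 2 * M := by
  rw [← integral_integral_cross_sq hf hs]
  have hc : Continuous fun x => ∫ y in a..b, (f x * s y - f y * s x) ^ 2 :=
    intervalIntegral.continuous_parametric_intervalIntegral_of_continuous' (by fun_prop) _ _
  calc _ ≤ ∫ x in a..b, (b - a) * M := by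
        refine intervalIntegral.integral_mono_on hab (hc.intervalIntegrable _ _) (by simp) ?_
        intro x hx
        calc _ ≤ ∫ y in a..b, M :=
              intervalIntegral.integral_mono_on hab
                (Continuous.intervalIntegrable (by fun_prop) _ _) (by simp) fun y hy => h x hx y hy
          _ = _ := by simp
    _ = _ := by simp; ring

/-- The oscillation of `f` over an interval is at most the integral of any bound on `|f'|`. -/
theorem abs_sub_le_integral {f f' h : ℝ → ℝ} (hf : ∀ x, HasDerivAt f (f' x) x)
    (hf' : Continuous f') (hh : Continuous h) {a b : ℝ}
    (hle : ∀ x ∈ Set.Icc a b, |f' x| ≤ h x) {x y : ℝ} (hx : x ∈ Set.Icc a b)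
    (hy : y ∈ Set.Icc a b) : |f x - f y| ≤ ∫ z in a..b, h z := by
  wlog hxy : y ≤ x generalizing x y
  · rw [abs_sub_comm]; exact this hy hx (le_of_not_ge hxy)
  have e : f x - f y = ∫ z in y..x, f' z :=
    (intervalIntegral.integral_eq_sub_of_hasDerivAt (fun z _ => hf z)
      (hf'.intervalIntegrable _ _)).symm
  rw [e]
  calc |∫ z in y..x, f' z| ≤ ∫ z in y..x, |f' z| :=
        intervalIntegral.abs_integral_le_integral_abs hxy
    _ ≤ ∫ z in y..x, h z :=
        intervalIntegral.integral_mono_on hxy (hf'.abs.intervalIntegrable _ _)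
          (hh.intervalIntegrable _ _) fun z hz => hle z ⟨hy.1.trans hz.1, hz.2.trans hx.2⟩
    _ ≤ ∫ z in a..b, h z := by
        refine intervalIntegral.integral_mono_interval hy.1 hxy hx.2 ?_ (hh.intervalIntegrable _ _)
        refine (ae_restrict_iff' measurableSet_Ioc).2 (Filter.Eventually.of_forall fun z hz => ?_)
        exact (abs_nonneg _).trans (hle z ⟨hz.1.le, hz.2⟩)

/-- The Poincaré inequality on an interval. -/
theorem poincare_interval {f f' : ℝ → ℝ} (hf : ∀ x, HasDerivAt f (f' x) x)
    (hf' : Continuous f') {a b : ℝ} (hab : a < b) :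
    ∫ x in a..b, f x ^ 2 ≤
      (b - a)⁻¹ * (∫ x in a..b, f x) ^ 2 + (b - a) ^ 2 * ∫ x in a..b, f' x ^ 2 := by
  have hfc : Continuous f := continuous_iff_continuousAt.2 fun x => (hf x).continuousAt
  have hI : 0 ≤ ∫ x in a..b, f' x ^ 2 :=
    intervalIntegral.integral_nonneg hab.le fun x _ => sq_nonneg _
  have h := gram_le_of_cross_sq_le hfc (continuous_const (y := (1 : ℝ))) hab.le
    (M := (b - a) * ∫ x in a..b, f' x ^ 2) (by
      intro x hx y hy
      have h1 := abs_sub_le_integral hf hf' hf'.abs (fun _ _ => le_rfl) hx hy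
      have h2 := sq_integral_le hf'.abs hab.le
      simp only [sq_abs] at h2
      rw [mul_one, mul_one, ← sq_abs]
      exact (pow_le_pow_left₀ (abs_nonneg _) h1 2).trans h2)
  simp only [mul_one, one_pow, intervalIntegral.integral_const, smul_eq_mul] at h
  have hpos : 0 < b - a := sub_pos.2 hab
  have : (b - a) * ∫ x in a..b, f x ^ 2 ≤
      (∫ x in a..b, f x) ^ 2 + (b - a) ^ 3 * ∫ x in a..b, f' x ^ 2 := by
    have : 0 ≤ (b - a) ^ 3 * ∫ x in a..b, f' x ^ 2 := by positivity
    nlinarith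
  rw [← mul_le_mul_iff_right₀ hpos]
  refine this.trans_eq ?_
  field_simp

/-- The increment of `f / sin` is controlled by the spectral excess `∫ f'² - f²`: with
`f = sin · v` the excess is `∫ sin² v'²`, and the weight `∫ₓʸ sin⁻²` is a difference of
cotangents. -/
theorem cross_sin_sq_le {f f' : ℝ → ℝ} (hf : ∀ x, HasDerivAt f (f' x) x) (hf' : Continuous f')
    (h0 : ∀ᶠ x in nhds 0, f x = 0) (hpi : ∀ᶠ x in nhds Real.pi, f x = 0)
    {x y : ℝ} (hx : x ∈ Set.Icc 0 Real.pi) (hy : y ∈ Set.Icc 0 Real.pi) :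
    (f x * Real.sin y - f y * Real.sin x) ^ 2 ≤ ∫ z in (0 : ℝ)..Real.pi, (f' z ^ 2 - f z ^ 2) := by
  have hfc : Continuous f := continuous_iff_continuousAt.2 fun x => (hf x).continuousAt
  wlog hxy : x ≤ y generalizing x y
  · have := this hy hx (le_of_not_ge hxy)
    rwa [← neg_sq, neg_sub]
  -- The function vanishes on `[0, δ]` and on `[π - δ, π]`.
  obtain ⟨d₀, hd₀, H0⟩ := Metric.eventually_nhds_iff.1 h0
  obtain ⟨d₁, hd₁, H1⟩ := Metric.eventually_nhds_iff.1 hpi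
  have hpi0 := Real.pi_pos
  have key : ∀ δ, 0 < δ → δ < d₀ → δ < d₁ → δ ≤ Real.pi / 2 →
      ∫ z in (0 : ℝ)..Real.pi, (f' z ^ 2 - f z ^ 2) =
        ∫ z in δ..(Real.pi - δ), (f' z - f z * (Real.cos z / Real.sin z)) ^ 2 := by
    intro δ hδ hδ0 hδ1 hδp
    have hd : ∀ z, |z| < d₀ → f z = 0 ∧ f' z = 0 := by
      intro z hz
      have hz' : ∀ᶠ t in nhds z, f t = 0 := by
        filter_upwards [(continuous_abs.tendsto z).eventually (gt_mem_nhds hz)] with t ht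
        exact H0 (by simpa [Real.dist_eq] using ht)
      exact ⟨hz'.self_of_nhds, (hf z).unique ((hasDerivAt_const z (0 : ℝ)).congr_of_eventuallyEq hz')⟩
    have hd' : ∀ z, |z - Real.pi| < d₁ → f z = 0 ∧ f' z = 0 := by
      intro z hz
      have hz' : ∀ᶠ t in nhds z, f t = 0 := by
        have hc : Continuous fun t : ℝ => |t - Real.pi| := by fun_prop
        filter_upwards [(hc.tendsto z).eventually (gt_mem_nhds hz)] with t ht
        exact H1 (by simpa [Real.dist_eq] using ht)
      exact ⟨hz'.self_of_nhds, (hf z).unique ((hasDerivAt_const z (0 : ℝ)).congr_of_eventuallyEq hz')⟩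
    have hi : ∀ u v, IntervalIntegrable (fun z => f' z ^ 2 - f z ^ 2) volume u v := fun u v =>
      Continuous.intervalIntegrable (by fun_prop) _ _
    have hsin : ∀ z ∈ Set.uIcc δ (Real.pi - δ), Real.sin z ≠ 0 := by
      intro z hz
      rw [Set.uIcc_of_le (by linarith)] at hz
      exact (Real.sin_pos_of_pos_of_lt_pi (by linarith [hz.1]) (by linarith [hz.2])).ne'
    rw [← intervalIntegral.integral_add_adjacent_intervals (hi 0 δ) (hi δ Real.pi),
      ← intervalIntegral.integral_add_adjacent_intervals (hi δ (Real.pi - δ)) (hi _ Real.pi)]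
    have e1 : ∫ z in (0 : ℝ)..δ, (f' z ^ 2 - f z ^ 2) = 0 := by
      refine (intervalIntegral.integral_congr (g := fun _ => (0 : ℝ)) fun z hz => ?_).trans (by simp)
      rw [Set.uIcc_of_le hδ.le] at hz
      have := hd z (by rw [abs_of_nonneg hz.1]; linarith [hz.2])
      simp [this.1, this.2]
    have e2 : ∫ z in (Real.pi - δ)..Real.pi, (f' z ^ 2 - f z ^ 2) = 0 := by
      refine (intervalIntegral.integral_congr (g := fun _ => (0 : ℝ)) fun z hz => ?_).trans (by simp)
      rw [Set.uIcc_of_le (by linarith)] at hz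
      have := hd' z (by rw [abs_of_nonpos (by linarith [hz.2])]; linarith [hz.1])
      simp [this.1, this.2]
    have e3 : ∫ z in δ..(Real.pi - δ), (2 * f z * f' z * (Real.cos z / Real.sin z)
        - f z ^ 2 * (1 + (Real.cos z / Real.sin z) ^ 2)) = 0 := by
      have hder : ∀ z ∈ Set.uIcc δ (Real.pi - δ),
          HasDerivAt (fun z => f z ^ 2 * (Real.cos z / Real.sin z))
            (2 * f z * f' z * (Real.cos z / Real.sin z)
              - f z ^ 2 * (1 + (Real.cos z / Real.sin z) ^ 2)) z := by
        intro z hz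
        have := ((hf z).pow 2).mul ((Real.hasDerivAt_cos z).div (Real.hasDerivAt_sin z) (hsin z hz))
        refine HasDerivAt.congr_deriv this ?_
        have := hsin z hz
        rw [Pi.pow_apply, Pi.div_apply]
        field_simp
        push_cast
        ring
      rw [intervalIntegral.integral_eq_sub_of_hasDerivAt hder]
      · rw [(hd δ (by rwa [abs_of_pos hδ])).1, (hd' (Real.pi - δ) (by simpa [abs_of_pos hδ])).1]
        simp
      · refine ContinuousOn.intervalIntegrable ?_
        have := hsin
        fun_prop (disch := assumption)
    rw [e1, e2, zero_add, add_zero, ← sub_zero (∫ z in δ..(Real.pi - δ), (f' z ^ 2 - f z ^ 2)),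
      ← e3, ← intervalIntegral.integral_sub (hi _ _)]
    · exact intervalIntegral.integral_congr fun z _ => by ring
    · refine ContinuousOn.intervalIntegrable ?_
      have := hsin
      fun_prop (disch := assumption)
  have hnn : 0 ≤ ∫ z in (0 : ℝ)..Real.pi, (f' z ^ 2 - f z ^ 2) := by
    set δ := min (min (d₀ / 2) (d₁ / 2)) (Real.pi / 2)
    have a1 : δ ≤ d₀ / 2 := (min_le_left _ _).trans (min_le_left _ _)
    have a2 : δ ≤ d₁ / 2 := (min_le_left _ _).trans (min_le_right _ _)
    have a3 : δ ≤ Real.pi / 2 := min_le_right _ _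
    rw [key δ (by positivity) (by linarith) (by linarith) a3]
    exact intervalIntegral.integral_nonneg (by linarith) fun z _ => sq_nonneg _
  rcases hx.1.eq_or_lt with rfl | hx0
  · rw [h0.self_of_nhds]; simpa using hnn
  rcases hy.2.eq_or_lt with rfl | hy0
  · rw [hpi.self_of_nhds]; simpa using hnn
  rcases hxy.eq_or_lt with rfl | hxy
  · simpa using hnn
  set δ := min (min (min (d₀ / 2) (d₁ / 2)) (Real.pi / 2)) (min x (Real.pi - y))
  have a1 : δ ≤ d₀ / 2 := ((min_le_left _ _).trans (min_le_left _ _)).trans (min_le_left _ _)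
  have a2 : δ ≤ d₁ / 2 := ((min_le_left _ _).trans (min_le_left _ _)).trans (min_le_right _ _)
  have a3 : δ ≤ Real.pi / 2 := (min_le_left _ _).trans (min_le_right _ _)
  have a4 : δ ≤ x := (min_le_right _ _).trans (min_le_left _ _)
  have a5 : δ ≤ Real.pi - y := (min_le_right _ _).trans (min_le_right _ _)
  have hδ : 0 < δ := by
    have : 0 < Real.pi - y := by linarith
    positivity
  rw [key δ hδ (by linarith) (by linarith) a3]
  have hsin : ∀ z ∈ Set.Icc δ (Real.pi - δ), 0 < Real.sin z := fun z hz =>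
    Real.sin_pos_of_pos_of_lt_pi (by linarith [hz.1]) (by linarith [hz.2])
  have hsx : 0 < Real.sin x := hsin x ⟨a4, by linarith⟩
  have hsy : 0 < Real.sin y := hsin y ⟨by linarith, by linarith⟩
  have hsub : Set.uIcc x y ⊆ Set.Icc δ (Real.pi - δ) := by
    rw [Set.uIcc_of_le hxy.le]
    exact Set.Icc_subset_Icc a4 (by linarith)
  have hne : ∀ z ∈ Set.uIcc x y, Real.sin z ≠ 0 := fun z hz => (hsin z (hsub hz)).ne'
  set A := ∫ z in x..y, (f' z - f z * (Real.cos z / Real.sin z)) ^ 2 with hA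
  have hqi : IntervalIntegrable (fun z => (f' z - f z * (Real.cos z / Real.sin z)) ^ 2) volume x y := by
    refine ContinuousOn.intervalIntegrable ?_
    fun_prop (disch := assumption)
  have hA' : A ≤ ∫ z in δ..(Real.pi - δ), (f' z - f z * (Real.cos z / Real.sin z)) ^ 2 := by
    refine intervalIntegral.integral_mono_interval a4 hxy.le (by linarith)
      (Filter.Eventually.of_forall fun z => sq_nonneg _) ?_
    refine ContinuousOn.intervalIntegrable ?_
    have : ∀ z ∈ Set.uIcc δ (Real.pi - δ), Real.sin z ≠ 0 := fun z hz =>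
      (hsin z (by rwa [Set.uIcc_of_le (by linarith)] at hz)).ne'
    fun_prop (disch := assumption)
  refine le_trans ?_ hA'
  have hB : ∫ z in x..y, (f' z - f z * (Real.cos z / Real.sin z)) / Real.sin z =
      f y / Real.sin y - f x / Real.sin x := by
    refine intervalIntegral.integral_eq_sub_of_hasDerivAt (f := fun z => f z / Real.sin z) ?_ ?_
    · intro z hz
      refine HasDerivAt.congr_deriv ((hf z).div (Real.hasDerivAt_sin z) (hne z hz)) ?_
      have := hne z hz
      field_simp
    · refine ContinuousOn.intervalIntegrable ?_
      fun_prop (disch := assumption)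
  have hC : ∫ z in x..y, (1 / Real.sin z ^ 2) =
      Real.cos x / Real.sin x - Real.cos y / Real.sin y := by
    rw [intervalIntegral.integral_eq_sub_of_hasDerivAt (f := fun z => -(Real.cos z / Real.sin z))]
    · ring
    · intro z hz
      refine HasDerivAt.congr_deriv
        ((Real.hasDerivAt_cos z).div (Real.hasDerivAt_sin z) (hne z hz)).neg ?_
      have := hne z hz
      field_simp
      linarith [Real.sin_sq_add_cos_sq z]
    · refine ContinuousOn.intervalIntegrable ?_
      fun_prop (disch := simp; assumption)
  set B := f y / Real.sin y - f x / Real.sin x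
  set C := Real.cos x / Real.sin x - Real.cos y / Real.sin y
  -- Cauchy–Schwarz through the nonnegative quadratic `t ↦ ∫ (q - t / sin)²`.
  have hquad : ∀ t : ℝ, 0 ≤ C * (t * t) + (-2 * B) * t + A := by
    intro t
    have h0 : 0 ≤ ∫ z in x..y,
        ((f' z - f z * (Real.cos z / Real.sin z)) - t * (1 / Real.sin z)) ^ 2 :=
      intervalIntegral.integral_nonneg hxy.le fun z _ => sq_nonneg _
    have h1 : ∫ z in x..y,
        ((f' z - f z * (Real.cos z / Real.sin z)) - t * (1 / Real.sin z)) ^ 2 =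
        A - (2 * t) * B + t ^ 2 * C := by
      rw [hA, ← hB, ← hC, ← intervalIntegral.integral_const_mul, ← intervalIntegral.integral_const_mul,
        ← intervalIntegral.integral_sub hqi, ← intervalIntegral.integral_add]
      · exact intervalIntegral.integral_congr fun z hz => by ring
      all_goals
        refine ContinuousOn.intervalIntegrable ?_
        fun_prop (disch := simp; assumption)
    rw [h1] at h0
    linarith
  have hdisc := discrim_le_zero hquad
  have hBC : B ^ 2 ≤ C * A := by
    unfold discrim at hdisc
    linarith
  have e1 : f x * Real.sin y - f y * Real.sin x = -(Real.sin x * Real.sin y * B) := by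
    simp only [B]; field_simp; ring
  have e2 : Real.sin x * Real.sin y * C = Real.sin (y - x) := by
    rw [Real.sin_sub]; simp only [C]; field_simp
  have hA0 : 0 ≤ A := intervalIntegral.integral_nonneg hxy.le fun z _ => sq_nonneg _
  calc (f x * Real.sin y - f y * Real.sin x) ^ 2
      = (Real.sin x * Real.sin y) ^ 2 * B ^ 2 := by rw [e1]; ring
    _ ≤ (Real.sin x * Real.sin y) ^ 2 * (C * A) := by gcongr
    _ = (Real.sin x * Real.sin y) * (Real.sin x * Real.sin y * C) * A := by ring
    _ = (Real.sin x * Real.sin y * Real.sin (y - x)) * A := by rw [e2]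
    _ ≤ 1 * A := by
        gcongr
        have h1 := Real.sin_le_one x
        have h2 := Real.sin_le_one y
        have h3 := Real.sin_le_one (y - x)
        have h4 : Real.sin x * Real.sin y ≤ 1 := mul_le_one₀ h1 hsy.le h2
        have h5 : 0 ≤ Real.sin (y - x) :=
          Real.sin_nonneg_of_nonneg_of_le_pi (by linarith) (by linarith)
        exact mul_le_one₀ h4 h5 h3
    _ = A := one_mul A

/-- A function on `(0, π)` with Dirichlet conditions is close to its projection onto the ground
state `sin`, and hence almost orthogonal to `cos`, up to the spectral excess. -/
theorem dirichlet_gap {f f' : ℝ → ℝ} (hf : ∀ x, HasDerivAt f (f' x) x) (hf' : Continuous f')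
    (h0 : ∀ᶠ x in nhds 0, f x = 0) (hpi : ∀ᶠ x in nhds Real.pi, f x = 0) :
    0 ≤ ∫ z in (0 : ℝ)..Real.pi, (f' z ^ 2 - f z ^ 2) ∧
    (∫ z in (0 : ℝ)..Real.pi, f z ^ 2) ≤ (∫ z in (0 : ℝ)..Real.pi, f z * Real.sin z) ^ 2 +
      4 * ∫ z in (0 : ℝ)..Real.pi, (f' z ^ 2 - f z ^ 2) ∧
    (∫ z in (0 : ℝ)..Real.pi, f z * Real.cos z) ^ 2 ≤
      64 * ∫ z in (0 : ℝ)..Real.pi, (f' z ^ 2 - f z ^ 2) := by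
  have hfc : Continuous f := continuous_iff_continuousAt.2 fun x => (hf x).continuousAt
  have key := fun x (hx : x ∈ Set.Icc 0 Real.pi) y (hy : y ∈ Set.Icc 0 Real.pi) =>
    cross_sin_sq_le hf hf' h0 hpi hx hy
  set D := ∫ z in (0 : ℝ)..Real.pi, (f' z ^ 2 - f z ^ 2)
  have hp := Real.pi_pos
  have hp4 := Real.pi_lt_four
  have hp3 := Real.pi_gt_three
  have hD : 0 ≤ D := (sq_nonneg _).trans (key 0 ⟨le_rfl, hp.le⟩ 0 ⟨le_rfl, hp.le⟩)
  have hs2 : ∫ z in (0 : ℝ)..Real.pi, Real.sin z ^ 2 = Real.pi / 2 := by simp [integral_sin_sq]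
  have hsc : ∫ z in (0 : ℝ)..Real.pi, Real.sin z * Real.cos z = 0 := by
    simp [integral_sin_mul_cos₁]
  refine ⟨hD, ?_, ?_⟩
  · have h := gram_le_of_cross_sq_le hfc Real.continuous_sin hp.le key
    rw [hs2, sub_zero] at h
    set F := ∫ z in (0 : ℝ)..Real.pi, f z ^ 2
    set a := ∫ z in (0 : ℝ)..Real.pi, f z * Real.sin z
    have : Real.pi * F ≤ Real.pi * (a ^ 2 + 4 * D) := by
      nlinarith [sq_nonneg a, mul_nonneg hp.le hD,
        mul_nonneg (mul_nonneg hp.le hD) (sub_nonneg.2 hp4.le)]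
    exact le_of_mul_le_mul_left this hp
  · set b := ∫ z in (0 : ℝ)..Real.pi, f z * Real.cos z
    have inner : ∀ x, ∫ y in (0 : ℝ)..Real.pi,
        (f x * Real.sin y - f y * Real.sin x) * (Real.cos x * Real.sin y) =
        f x * Real.cos x * (Real.pi / 2) -
          Real.sin x * Real.cos x * ∫ y in (0 : ℝ)..Real.pi, f y * Real.sin y := by
      intro x
      rw [← hs2, ← intervalIntegral.integral_const_mul, ← intervalIntegral.integral_const_mul,
        ← intervalIntegral.integral_sub]
      · exact intervalIntegral.integral_congr fun y _ => by ring
      all_goals exact Continuous.intervalIntegrable (by fun_prop) _ _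
    have houter : ∫ x in (0 : ℝ)..Real.pi, ∫ y in (0 : ℝ)..Real.pi,
        (f x * Real.sin y - f y * Real.sin x) * (Real.cos x * Real.sin y) = b * (Real.pi / 2) := by
      simp_rw [inner]
      rw [intervalIntegral.integral_sub, intervalIntegral.integral_mul_const,
        intervalIntegral.integral_mul_const, hsc]
      · simp [b]
      all_goals exact Continuous.intervalIntegrable (by fun_prop) _ _
    have hbound : |b * (Real.pi / 2)| ≤ Real.sqrt D * |Real.pi - 0| * |Real.pi - 0| := by
      rw [← houter, ← Real.norm_eq_abs]
      refine intervalIntegral.norm_integral_le_of_norm_le_const fun x hx => ?_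
      refine intervalIntegral.norm_integral_le_of_norm_le_const fun y hy => ?_
      rw [Set.uIoc_of_le hp.le] at hx hy
      rw [Real.norm_eq_abs, abs_mul]
      have h1 := Real.abs_le_sqrt (key x ⟨hx.1.le, hx.2⟩ y ⟨hy.1.le, hy.2⟩)
      have h2 : |Real.cos x * Real.sin y| ≤ 1 := by
        rw [abs_mul]
        exact mul_le_one₀ (Real.abs_cos_le_one x) (abs_nonneg _) (Real.abs_sin_le_one y)
      calc _ ≤ Real.sqrt D * 1 := by gcongr
        _ = _ := mul_one _
    rw [sub_zero, abs_of_pos hp, abs_mul, abs_of_pos (half_pos hp)] at hbound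
    have hb : |b| ≤ 8 * Real.sqrt D := by
      have h1 : |b| ≤ 2 * Real.pi * Real.sqrt D := by
        refine le_of_mul_le_mul_right ?_ (half_pos hp)
        linarith
      have := Real.sqrt_nonneg D
      nlinarith
    calc b ^ 2 = |b| ^ 2 := (sq_abs b).symm
      _ ≤ (8 * Real.sqrt D) ^ 2 := by gcongr
      _ = 64 * D := by rw [mul_pow, Real.sq_sqrt hD]; norm_num

/-! ### Fibres, cells and blocks of a straightened waveguide -/

theorem hasDerivAt_integral_param {F Fx : ℝ → ℝ → ℝ}
    (hF : Continuous fun p : ℝ × ℝ => F p.1 p.2) (hFx : Continuous fun p : ℝ × ℝ => Fx p.1 p.2)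
    (h : ∀ x y, HasDerivAt (fun x => F x y) (Fx x y) x) (c d x : ℝ) :
    HasDerivAt (fun x => ∫ y in c..d, F x y) (∫ y in c..d, Fx x y) x := by
  obtain ⟨C, hC⟩ := ((isCompact_closedBall x 1).prod (isCompact_uIcc (a := c) (b := d))).exists_bound_of_continuousOn
    hFx.continuousOn
  have hFy : ∀ x, Continuous (F x) := fun x => hF.comp (by fun_prop : Continuous fun y => (x, y))
  have hFxy : ∀ x, Continuous (Fx x) := fun x => hFx.comp (by fun_prop : Continuous fun y => (x, y))
  refine (intervalIntegral.hasDerivAt_integral_of_dominated_loc_of_deriv_le (bound := fun _ => C)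
    (Metric.closedBall_mem_nhds x one_pos) ?_ ?_ ?_ ?_ (by simp) ?_).2
  · exact Filter.Eventually.of_forall fun z => (hFy z).aestronglyMeasurable
  · exact (hFy x).intervalIntegrable _ _
  · exact (hFxy x).aestronglyMeasurable
  · exact Filter.Eventually.of_forall fun y hy z hz => hC (z, y) ⟨hz, Set.uIoc_subset_uIcc hy⟩
  · exact Filter.Eventually.of_forall fun y _ z _ => h z y

/-- A continuously differentiable function `F` on the plane, listed with its partial derivatives
`Fx` and `Fy`, that vanishes near the horizontal sides of the rectangle `[0, L] × [0, π]`. -/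
structure IsStripFunction (L : ℝ) (F Fx Fy : ℝ → ℝ → ℝ) : Prop where
  cont : Continuous fun p : ℝ × ℝ => F p.1 p.2
  cont_x : Continuous fun p : ℝ × ℝ => Fx p.1 p.2
  cont_y : Continuous fun p : ℝ × ℝ => Fy p.1 p.2
  deriv_x : ∀ x y, HasDerivAt (fun x => F x y) (Fx x y) x
  deriv_y : ∀ x y, HasDerivAt (F x) (Fy x y) y
  zero_bot : ∀ x ∈ Set.Icc 0 L, ∀ᶠ y in nhds 0, F x y = 0
  zero_top : ∀ x ∈ Set.Icc 0 L, ∀ᶠ y in nhds Real.pi, F x y = 0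

/-- The excess of the energy of the fibre over `x` above the threshold `1`, for the waveguide whose
walls have slope `τ`: in straightened coordinates the longitudinal derivative is `∂ₓ - τ ∂ᵧ`. -/
noncomputable def excess (F Fx Fy : ℝ → ℝ → ℝ) (τ : ℝ → ℝ) (x : ℝ) : ℝ :=
  ∫ y in (0 : ℝ)..Real.pi, ((Fx x y - τ x * Fy x y) ^ 2 + (Fy x y ^ 2 - F x y ^ 2))

theorem continuous_fibre_integral {H : ℝ → ℝ → ℝ} (hH : Continuous fun p : ℝ × ℝ => H p.1 p.2)
    (c d : ℝ) : Continuous fun x => ∫ y in c..d, H x y :=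
  intervalIntegral.continuous_parametric_intervalIntegral_of_continuous' hH c d

theorem continuous_excess {L : ℝ} {F Fx Fy : ℝ → ℝ → ℝ} (S : IsStripFunction L F Fx Fy) {τ : ℝ → ℝ}
    (hτ : Continuous τ) : Continuous (excess F Fx Fy τ) := by
  have := S.cont
  have := S.cont_x
  have := S.cont_y
  exact continuous_fibre_integral (H := fun x y => (Fx x y - τ x * Fy x y) ^ 2 +
    (Fy x y ^ 2 - F x y ^ 2)) (by fun_prop) _ _

/-- The first two trigonometric moments `∫ F sin` and `∫ F cos` of the fibres rotate into each other
at the rate `τ`, up to errors controlled by the excess. -/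
theorem fibre_estimates {L : ℝ} {F Fx Fy : ℝ → ℝ → ℝ} (S : IsStripFunction L F Fx Fy)
    {τ : ℝ → ℝ} {x : ℝ} (hx : x ∈ Set.Icc 0 L) (hτ : |τ x| ≤ 1) :
    0 ≤ excess F Fx Fy τ x ∧
    |∫ y in (0 : ℝ)..Real.pi, F x y * Real.cos y| ≤ 8 * √(excess F Fx Fy τ x) ∧
    |∫ y in (0 : ℝ)..Real.pi, Fx x y * Real.sin y| ≤ 10 * √(excess F Fx Fy τ x) ∧
    |(∫ y in (0 : ℝ)..Real.pi, Fx x y * Real.cos y) -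
      τ x * ∫ y in (0 : ℝ)..Real.pi, F x y * Real.sin y| ≤ 2 * √(excess F Fx Fy τ x) ∧
    ∫ y in (0 : ℝ)..Real.pi, F x y ^ 2 ≤
      (∫ y in (0 : ℝ)..Real.pi, F x y * Real.sin y) ^ 2 + 4 * excess F Fx Fy τ x := by
  have cF : Continuous (F x) := S.cont.comp (by fun_prop : Continuous fun y => (x, y))
  have cx : Continuous (Fx x) := S.cont_x.comp (by fun_prop : Continuous fun y => (x, y))
  have cy : Continuous (Fy x) := S.cont_y.comp (by fun_prop : Continuous fun y => (x, y))
  obtain ⟨hD, hF2, hcos⟩ := dirichlet_gap (S.deriv_y x) cy (S.zero_bot x hx) (S.zero_top x hx)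
  have cP : Continuous fun y => Fx x y - τ x * Fy x y := by fun_prop
  set e := excess F Fx Fy τ x with he
  have hsplit : e = (∫ y in (0 : ℝ)..Real.pi, (Fx x y - τ x * Fy x y) ^ 2) +
      ∫ y in (0 : ℝ)..Real.pi, (Fy x y ^ 2 - F x y ^ 2) := by
    rw [he, excess, intervalIntegral.integral_add] <;>
    exact Continuous.intervalIntegrable (by fun_prop) _ _
  set D := ∫ y in (0 : ℝ)..Real.pi, (Fy x y ^ 2 - F x y ^ 2)
  set m := ∫ y in (0 : ℝ)..Real.pi, (Fx x y - τ x * Fy x y) ^ 2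
  have hp := Real.pi_pos
  have hp4 := Real.pi_lt_four
  have hm : 0 ≤ m := intervalIntegral.integral_nonneg hp.le fun _ _ => sq_nonneg _
  have he0 : 0 ≤ e := by rw [hsplit]; positivity
  have b1 : |∫ y in (0 : ℝ)..Real.pi, F x y * Real.cos y| ≤ 8 * √e := by
    refine abs_le_of_sq_le_sq ?_ (by positivity)
    rw [mul_pow, Real.sq_sqrt he0]; linarith
  have b2 : |∫ y in (0 : ℝ)..Real.pi, (Fx x y - τ x * Fy x y) * Real.sin y| ≤ 2 * √e := by
    refine abs_le_of_sq_le_sq ?_ (by positivity)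
    have := sq_integral_mul_le cP Real.continuous_sin hp.le
    have hs2 : ∫ z in (0 : ℝ)..Real.pi, Real.sin z ^ 2 = Real.pi / 2 := by simp [integral_sin_sq]
    rw [hs2] at this
    rw [mul_pow, Real.sq_sqrt he0]; nlinarith
  have b3 : |∫ y in (0 : ℝ)..Real.pi, (Fx x y - τ x * Fy x y) * Real.cos y| ≤ 2 * √e := by
    refine abs_le_of_sq_le_sq ?_ (by positivity)
    have := sq_integral_mul_le cP Real.continuous_cos hp.le
    have hs2 : ∫ z in (0 : ℝ)..Real.pi, Real.cos z ^ 2 = Real.pi / 2 := by simp [integral_cos_sq]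
    rw [hs2] at this
    rw [mul_pow, Real.sq_sqrt he0]; nlinarith
  have v0 : F x 0 = 0 := (S.zero_bot x hx).self_of_nhds
  have vp : F x Real.pi = 0 := (S.zero_top x hx).self_of_nhds
  have p1 : ∫ y in (0 : ℝ)..Real.pi, Fy x y * Real.sin y =
      -∫ y in (0 : ℝ)..Real.pi, F x y * Real.cos y := by
    have := intervalIntegral.integral_deriv_mul_eq_sub (a := 0) (b := Real.pi)
      (fun y _ => S.deriv_y x y) (fun y _ => Real.hasDerivAt_sin y)
      (cy.intervalIntegrable _ _) (Real.continuous_cos.intervalIntegrable _ _)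
    rw [intervalIntegral.integral_add (Continuous.intervalIntegrable (by fun_prop) _ _)
      (Continuous.intervalIntegrable (by fun_prop) _ _)] at this
    simp only [v0, vp, zero_mul, sub_zero] at this
    linarith
  have p2 : ∫ y in (0 : ℝ)..Real.pi, Fy x y * Real.cos y =
      ∫ y in (0 : ℝ)..Real.pi, F x y * Real.sin y := by
    have := intervalIntegral.integral_deriv_mul_eq_sub (a := 0) (b := Real.pi)
      (fun y _ => S.deriv_y x y) (fun y _ => Real.hasDerivAt_cos y)
      (cy.intervalIntegrable _ _) ((Real.continuous_sin.neg).intervalIntegrable _ _)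
    rw [intervalIntegral.integral_add (Continuous.intervalIntegrable (by fun_prop) _ _)
      (Continuous.intervalIntegrable (by fun_prop) _ _)] at this
    simp only [v0, vp, zero_mul, sub_zero, mul_neg, intervalIntegral.integral_neg] at this
    linarith
  have q1 : ∫ y in (0 : ℝ)..Real.pi, (Fx x y - τ x * Fy x y) * Real.sin y =
      (∫ y in (0 : ℝ)..Real.pi, Fx x y * Real.sin y) -
        τ x * ∫ y in (0 : ℝ)..Real.pi, Fy x y * Real.sin y := by
    rw [← intervalIntegral.integral_const_mul, ← intervalIntegral.integral_sub]
    · exact intervalIntegral.integral_congr fun y _ => by ring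
    all_goals exact Continuous.intervalIntegrable (by fun_prop) _ _
  have q2 : ∫ y in (0 : ℝ)..Real.pi, (Fx x y - τ x * Fy x y) * Real.cos y =
      (∫ y in (0 : ℝ)..Real.pi, Fx x y * Real.cos y) -
        τ x * ∫ y in (0 : ℝ)..Real.pi, Fy x y * Real.cos y := by
    rw [← intervalIntegral.integral_const_mul, ← intervalIntegral.integral_sub]
    · exact intervalIntegral.integral_congr fun y _ => by ring
    all_goals exact Continuous.intervalIntegrable (by fun_prop) _ _
  refine ⟨he0, b1, ?_, ?_, by linarith⟩
  · rw [q1, p1] at b2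
    set b := ∫ y in (0 : ℝ)..Real.pi, F x y * Real.cos y
    have h1 : |τ x * b| ≤ 8 * √e := by
      rw [abs_mul]
      calc |τ x| * |b| ≤ 1 * |b| := by gcongr
        _ ≤ _ := by rwa [one_mul]
    rw [abs_le] at *
    constructor <;> linarith [h1.1, h1.2, b2.1, b2.2]
  · rwa [q2, p2] at b3

/-- Over one cell, testing the rotation equation for `b` with the slope `γ` of the bump bounds the
weighted mean of `a` by the error function `h`. -/
theorem cell_mean_bound {a b b' h γ γ' : ℝ → ℝ} {u v t : ℝ} (huv : u ≤ v)
    (ha : Continuous a) (hb : ∀ x, HasDerivAt b (b' x) x) (hb' : Continuous b') (hh : Continuous h)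
    (hγ : ∀ x, HasDerivAt γ (γ' x) x) (hγ' : Continuous γ')
    (hu : γ u = 0) (hv : γ v = 0)
    (hγ1 : ∀ x ∈ Set.Icc u v, |γ x| ≤ 1) (hγ1' : ∀ x ∈ Set.Icc u v, |γ' x| ≤ 1)
    (hbh : ∀ x ∈ Set.Icc u v, |b x| ≤ 8 * h x)
    (hrot : ∀ x ∈ Set.Icc u v, |b' x - t * γ x * a x| ≤ 2 * h x) :
    |t * ∫ x in u..v, γ x ^ 2 * a x| ≤ 10 * ∫ x in u..v, h x := by
  have hbc : Continuous b := continuous_iff_continuousAt.2 fun x => (hb x).continuousAt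
  have hγc : Continuous γ := continuous_iff_continuousAt.2 fun x => (hγ x).continuousAt
  have ibp : ∫ x in u..v, (γ' x * b x + γ x * b' x) = 0 := by
    rw [intervalIntegral.integral_deriv_mul_eq_sub (fun x _ => hγ x) (fun x _ => hb x)
      (hγ'.intervalIntegrable _ _) (hb'.intervalIntegrable _ _), hu, hv]
    simp
  have e : t * ∫ x in u..v, γ x ^ 2 * a x =
      ∫ x in u..v, (-(γ' x * b x) - γ x * (b' x - t * γ x * a x)) := by
    rw [← intervalIntegral.integral_const_mul, ← sub_zero (∫ x in u..v, t * (γ x ^ 2 * a x)), ← ibp,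
      ← intervalIntegral.integral_sub]
    · exact intervalIntegral.integral_congr fun x _ => by ring
    all_goals exact Continuous.intervalIntegrable (by fun_prop) _ _
  rw [e, ← intervalIntegral.integral_const_mul]
  refine (intervalIntegral.abs_integral_le_integral_abs huv).trans ?_
  refine intervalIntegral.integral_mono_on huv (Continuous.intervalIntegrable (by fun_prop) _ _)
    (Continuous.intervalIntegrable (by fun_prop) _ _) fun x hx => ?_
  have h1 : |γ' x * b x| ≤ 8 * h x := by
    rw [abs_mul]
    exact (mul_le_of_le_one_left (abs_nonneg _) (hγ1' x hx)).trans (hbh x hx)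
  have h2 : |γ x * (b' x - t * γ x * a x)| ≤ 2 * h x := by
    rw [abs_mul]
    exact (mul_le_of_le_one_left (abs_nonneg _) (hγ1 x hx)).trans (hrot x hx)
  rw [abs_le] at *
  constructor <;> linarith [h1.1, h1.2, h2.1, h2.2]

/-- Over a block of cells `n ≤ k < m`, the cell bounds add up to a pointwise bound on `a`. -/
theorem block_pointwise_bound {a a' b b' h γ γ' : ℝ → ℝ} {l : ℝ} (hl : 0 < l) {n m : ℕ} (hnm : n ≤ m)
    {t : ℕ → ℝ} (ht : ∀ k, 0 ≤ t k)
    (ha : ∀ x, HasDerivAt a (a' x) x) (ha' : Continuous a')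
    (hb : ∀ x, HasDerivAt b (b' x) x) (hb' : Continuous b') (hh : Continuous h)
    (hγ : ∀ x, HasDerivAt γ (γ' x) x) (hγ' : Continuous γ')
    (hγ0 : γ 0 = 0) (hγl : γ l = 0)
    (hγ1 : ∀ x ∈ Set.Icc 0 l, |γ x| ≤ 1) (hγ1' : ∀ x ∈ Set.Icc 0 l, |γ' x| ≤ 1)
    (hah : ∀ x ∈ Set.Icc (n * l) (m * l), |a' x| ≤ 10 * h x)
    (hbh : ∀ x ∈ Set.Icc (n * l) (m * l), |b x| ≤ 8 * h x)
    (hrot : ∀ k ∈ Finset.Ico n m, ∀ x ∈ Set.Icc (k * l) ((k + 1) * l),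
      |b' x - t k * γ (x - k * l) * a x| ≤ 2 * h x)
    {x : ℝ} (hx : x ∈ Set.Icc (n * l) (m * l)) :
    (∑ k ∈ Finset.Ico n m, t k) * (∫ z in (0 : ℝ)..l, γ z ^ 2) * |a x| ≤
      10 * (1 + (∑ k ∈ Finset.Ico n m, t k) * ∫ z in (0 : ℝ)..l, γ z ^ 2) *
        ∫ z in (n * l)..(m * l), h z := by
  have hac : Continuous a := continuous_iff_continuousAt.2 fun x => (ha x).continuousAt
  have hγc : Continuous γ := continuous_iff_continuousAt.2 fun x => (hγ x).continuousAt
  set Γ := ∫ z in (0 : ℝ)..l, γ z ^ 2 with hΓ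
  set H := ∫ z in (n * l)..(m * l), h z with hH
  have cell : ∀ k ∈ Finset.Ico n m, t k * Γ * |a x| ≤
      10 * (∫ z in ((k : ℕ) * l)..((k + 1 : ℕ) * l), h z) + t k * Γ * (10 * H) := by
    intro k hk
    have hk' := Finset.mem_Ico.1 hk
    have hkl : (k : ℝ) * l ≤ (k + 1) * l := by nlinarith
    have hsub : Set.Icc ((k : ℝ) * l) ((k + 1) * l) ⊆ Set.Icc (n * l) (m * l) := by
      refine Set.Icc_subset_Icc ?_ ?_
      · gcongr; exact hk'.1
      · gcongr; exact_mod_cast hk'.2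
    have hsh : ∀ z ∈ Set.Icc ((k : ℝ) * l) ((k + 1) * l), z - k * l ∈ Set.Icc 0 l := fun z hz =>
      ⟨by linarith [hz.1], by linarith [hz.2]⟩
    have c1 := cell_mean_bound (a := a) (t := t k) (γ := fun z => γ (z - k * l))
      (γ' := fun z => γ' (z - k * l)) hkl hac hb hb' hh
      (fun z => (hγ (z - k * l)).comp_sub_const z (k * l))
      (by fun_prop) (by simpa using hγ0) (by simpa [add_mul] using hγl)
      (fun z hz => hγ1 _ (hsh z hz)) (fun z hz => hγ1' _ (hsh z hz))
      (fun z hz => hbh z (hsub hz)) (hrot k hk)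
    have hΓk : ∫ z in ((k : ℝ) * l)..((k + 1) * l), γ (z - k * l) ^ 2 = Γ := by
      rw [intervalIntegral.integral_comp_sub_right (fun z => γ z ^ 2)]
      simp [hΓ, add_mul]
    have c2 : |∫ z in ((k : ℝ) * l)..((k + 1) * l), γ (z - k * l) ^ 2 * (a x - a z)| ≤
        Γ * (10 * H) := by
      rw [← hΓk, ← intervalIntegral.integral_mul_const]
      refine (intervalIntegral.abs_integral_le_integral_abs hkl).trans ?_
      refine intervalIntegral.integral_mono_on hkl (Continuous.intervalIntegrable (by fun_prop) _ _)
        (Continuous.intervalIntegrable (by fun_prop) _ _) fun z hz => ?_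
      rw [abs_mul, abs_of_nonneg (sq_nonneg _)]
      gcongr
      have := abs_sub_le_integral ha ha' (h := fun z => 10 * h z) (by fun_prop) hah hx (hsub hz)
      rwa [intervalIntegral.integral_const_mul] at this
    have c3 : t k * Γ * a x = t k * (∫ z in ((k : ℝ) * l)..((k + 1) * l), γ (z - k * l) ^ 2 * a z) +
        t k * ∫ z in ((k : ℝ) * l)..((k + 1) * l), γ (z - k * l) ^ 2 * (a x - a z) := by
      rw [← mul_add, ← intervalIntegral.integral_add, ← hΓk, mul_assoc,
        ← intervalIntegral.integral_mul_const]
      · congr 1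
        exact intervalIntegral.integral_congr fun z _ => by ring
      all_goals exact Continuous.intervalIntegrable (by fun_prop) _ _
    have hΓ0 : 0 ≤ Γ := intervalIntegral.integral_nonneg hl.le fun z _ => sq_nonneg _
    calc t k * Γ * |a x| = |t k * Γ * a x| := by
          rw [abs_mul, abs_of_nonneg (mul_nonneg (ht k) hΓ0)]
      _ ≤ _ := by
          rw [c3]
          refine (abs_add_le _ _).trans ?_
          rw [abs_mul (t k) (∫ z in ((k : ℝ) * l)..((k + 1) * l), γ (z - k * l) ^ 2 * (a x - a z)),
            abs_of_nonneg (ht k)]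
          have := mul_le_mul_of_nonneg_left c2 (ht k)
          push_cast
          linarith
  have hsum : ∑ k ∈ Finset.Ico n m, (∫ z in ((k : ℕ) * l)..((k + 1 : ℕ) * l), h z) = H :=
    intervalIntegral.sum_integral_adjacent_intervals_Ico (a := fun k : ℕ => (k : ℝ) * l) hnm
      fun k _ => hh.intervalIntegrable _ _
  calc (∑ k ∈ Finset.Ico n m, t k) * Γ * |a x|
      = ∑ k ∈ Finset.Ico n m, t k * Γ * |a x| := by rw [Finset.sum_mul, Finset.sum_mul]
    _ ≤ ∑ k ∈ Finset.Ico n m, (10 * (∫ z in ((k : ℕ) * l)..((k + 1 : ℕ) * l), h z) +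
          t k * Γ * (10 * H)) := Finset.sum_le_sum cell
    _ = _ := by
        rw [Finset.sum_add_distrib, ← Finset.mul_sum, hsum, ← Finset.sum_mul, ← Finset.sum_mul]
        ring

/-- The spectral gap of a block of cells: the mass is bounded by the energy excess. -/
theorem block_mass_le {L : ℝ} {F Fx Fy : ℝ → ℝ → ℝ} (S : IsStripFunction L F Fx Fy)
    {τ γ γ' : ℝ → ℝ} (hτ : Continuous τ) (hτ1 : ∀ x ∈ Set.Icc 0 L, |τ x| ≤ 1)
    {l : ℝ} (hl : 0 < l) {n m : ℕ} (hnm : n ≤ m) (hmL : m * l ≤ L)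
    {t : ℕ → ℝ} (ht : ∀ k, 0 ≤ t k)
    (hγ : ∀ x, HasDerivAt γ (γ' x) x) (hγ' : Continuous γ')
    (hγ0 : γ 0 = 0) (hγl : γ l = 0)
    (hγ1 : ∀ x ∈ Set.Icc 0 l, |γ x| ≤ 1) (hγ1' : ∀ x ∈ Set.Icc 0 l, |γ' x| ≤ 1)
    (hcell : ∀ k ∈ Finset.Ico n m, ∀ x ∈ Set.Icc (k * l) ((k + 1) * l), τ x = t k * γ (x - k * l))
    {W M : ℝ} (hW : 0 < W)
    (hWle : W ≤ (∑ k ∈ Finset.Ico n m, t k) * ∫ z in (0 : ℝ)..l, γ z ^ 2)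
    (hM : 100 * ((m - n) * l) ^ 2 * (W⁻¹ + 1) ^ 2 + 4 ≤ M) :
    ∫ x in (n * l)..(m * l), ∫ y in (0 : ℝ)..Real.pi, F x y ^ 2 ≤
      M * ∫ x in (n * l)..(m * l), excess F Fx Fy τ x := by
  have cF := S.cont
  have cFx := S.cont_x
  set e := excess F Fx Fy τ with he
  have hec : Continuous e := continuous_excess S hτ
  have hab : (n : ℝ) * l ≤ m * l := by gcongr
  have hsub : Set.Icc ((n : ℝ) * l) (m * l) ⊆ Set.Icc 0 L :=
    Set.Icc_subset_Icc (by positivity) hmL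
  have est := fun x (hx : x ∈ Set.Icc ((n : ℝ) * l) (m * l)) =>
    fibre_estimates S (hsub hx) (hτ1 x (hsub hx))
  set a : ℝ → ℝ := fun x => ∫ y in (0 : ℝ)..Real.pi, F x y * Real.sin y with ha
  have hac : Continuous a :=
    continuous_fibre_integral (H := fun x y => F x y * Real.sin y) (by fun_prop) _ _
  have hda : ∀ x, HasDerivAt a (∫ y in (0 : ℝ)..Real.pi, Fx x y * Real.sin y) x := fun x =>
    hasDerivAt_integral_param (F := fun x y => F x y * Real.sin y)
      (Fx := fun x y => Fx x y * Real.sin y) (by fun_prop) (by fun_prop)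
      (fun x y => (S.deriv_x x y).mul_const _) _ _ _
  have hdb : ∀ x, HasDerivAt (fun x => ∫ y in (0 : ℝ)..Real.pi, F x y * Real.cos y)
      (∫ y in (0 : ℝ)..Real.pi, Fx x y * Real.cos y) x := fun x =>
    hasDerivAt_integral_param (F := fun x y => F x y * Real.cos y)
      (Fx := fun x y => Fx x y * Real.cos y) (by fun_prop) (by fun_prop)
      (fun x y => (S.deriv_x x y).mul_const _) _ _ _
  have hpt := fun x (hx : x ∈ Set.Icc ((n : ℝ) * l) (m * l)) =>
    block_pointwise_bound (h := fun x => √(e x)) hl hnm ht hda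
      (continuous_fibre_integral (H := fun x y => Fx x y * Real.sin y) (by fun_prop) _ _) hdb
      (continuous_fibre_integral (H := fun x y => Fx x y * Real.cos y) (by fun_prop) _ _)
      (by fun_prop) hγ hγ' hγ0 hγl hγ1 hγ1' (fun x hx => (est x hx).2.2.1)
      (fun x hx => (est x hx).2.1) (fun k hk x hx => by
        rw [← hcell k hk x hx]
        refine (est x ?_).2.2.2.1
        have hk' := Finset.mem_Ico.1 hk
        refine ⟨le_trans ?_ hx.1, hx.2.trans ?_⟩
        · gcongr; exact hk'.1
        · gcongr; exact_mod_cast hk'.2) hx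
  set V := (∑ k ∈ Finset.Ico n m, t k) * ∫ z in (0 : ℝ)..l, γ z ^ 2 with hV
  set H := ∫ z in (n * l)..(m * l), √(e z) with hH
  set E := ∫ z in (n * l)..(m * l), e z with hE
  have hVpos : 0 < V := hW.trans_le hWle
  have hH0 : 0 ≤ H := intervalIntegral.integral_nonneg hab fun _ _ => Real.sqrt_nonneg _
  have hH2 : H ^ 2 ≤ (m * l - n * l) * E := by
    refine (sq_integral_le (f := fun z => √(e z)) (by fun_prop) hab).trans_eq ?_
    congr 1
    refine intervalIntegral.integral_congr fun z hz => ?_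
    rw [Set.uIcc_of_le hab] at hz
    exact Real.sq_sqrt (est z hz).1
  have hE0 : 0 ≤ E := intervalIntegral.integral_nonneg hab fun z hz => (est z hz).1
  have hpt' : ∀ x ∈ Set.Icc ((n : ℝ) * l) (m * l),
      a x ^ 2 ≤ 100 * (W⁻¹ + 1) ^ 2 * ((m * l - n * l) * E) := by
    intro x hx
    have h1 : |a x| ≤ 10 * (W⁻¹ + 1) * H := by
      have h2 : |a x| ≤ 10 * (V⁻¹ + 1) * H := by
        refine le_of_mul_le_mul_left ((hpt x hx).trans_eq ?_) hVpos
        field_simp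
      refine h2.trans ?_
      gcongr
    calc a x ^ 2 = |a x| ^ 2 := (sq_abs _).symm
      _ ≤ (10 * (W⁻¹ + 1) * H) ^ 2 := by gcongr
      _ = 100 * (W⁻¹ + 1) ^ 2 * H ^ 2 := by ring
      _ ≤ _ := by gcongr
  have hcF2 : Continuous fun x => ∫ y in (0 : ℝ)..Real.pi, F x y ^ 2 :=
    continuous_fibre_integral (H := fun x y => F x y ^ 2) (by fun_prop) _ _
  calc ∫ x in (n * l)..(m * l), ∫ y in (0 : ℝ)..Real.pi, F x y ^ 2
      ≤ ∫ x in (n * l)..(m * l),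
          (100 * (W⁻¹ + 1) ^ 2 * ((m * l - n * l) * E) + 4 * e x) := by
        refine intervalIntegral.integral_mono_on hab (hcF2.intervalIntegrable _ _)
          (Continuous.intervalIntegrable (by fun_prop) _ _) fun x hx => ?_
        have h1 := (est x hx).2.2.2.2
        have h2 := hpt' x hx
        linarith
    _ = (100 * ((m - n) * l) ^ 2 * (W⁻¹ + 1) ^ 2 + 4) * E := by
        rw [intervalIntegral.integral_add (by simp) (Continuous.intervalIntegrable (by fun_prop) _ _),
          intervalIntegral.integral_const, intervalIntegral.integral_const_mul, smul_eq_mul]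
        ring
    _ ≤ M * E := by gcongr

/-! ### Eigenvalues by the direct method -/

open Filter Topology in
/-- The direct method of the calculus of variations, for a closed form given by its graph `S` (triples
of a vector and the two components of its gradient).  The hypothesis `hcpt` expresses that the form
domain embeds compactly into the Hilbert space. -/
theorem exists_minimizer {H : Type*} [NormedAddCommGroup H] [InnerProductSpace ℝ H] [CompleteSpace H]
    (S : Submodule ℝ (H × H × H)) (hS : IsClosed (S : Set (H × H × H)))
    (hcpt : ∀ ε : ℝ, 0 < ε → ∃ (ι : Type) (_ : Fintype ι) (χ : ι → H), ∀ p ∈ S,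
      ‖p.1‖ ^ 2 ≤ ε * (‖p.2.1‖ ^ 2 + ‖p.2.2‖ ^ 2) + ∑ i, inner ℝ (χ i) p.1 ^ 2)
    (hne : ∃ p ∈ S, p.1 ≠ 0) :
    ∃ p ∈ S, ∃ E : ℝ, p.1 ≠ 0 ∧ ∀ z ∈ S,
      inner ℝ p.2.1 z.2.1 + inner ℝ p.2.2 z.2.2 = inner ℝ (E • p.1) z.1 := by
  set q : H × H × H → ℝ := fun p => ‖p.2.1‖ ^ 2 + ‖p.2.2‖ ^ 2 with hq
  have hq0 : ∀ p, 0 ≤ q p := fun p => by positivity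
  have hqs : ∀ (c : ℝ) p, q (c • p) = c ^ 2 * q p := by
    intro c p; simp only [hq, Prod.smul_snd, Prod.smul_fst, norm_smul, mul_pow, Real.norm_eq_abs, sq_abs]; ring
  set Q : Set ℝ := q '' {p | p ∈ S ∧ ‖p.1‖ = 1} with hQ
  have hbdd : BddBelow Q := ⟨0, by rintro _ ⟨p, -, rfl⟩; exact hq0 p⟩
  have hnorm : ∀ p ∈ S, p.1 ≠ 0 → ‖p.1‖⁻¹ • p ∈ {p | p ∈ S ∧ ‖p.1‖ = 1} := fun p hp h =>
    ⟨S.smul_mem _ hp, by rw [Prod.smul_fst, norm_smul, norm_inv, norm_norm, inv_mul_cancel₀ (norm_ne_zero_iff.2 h)]⟩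
  have hQne : Q.Nonempty := by
    obtain ⟨p, hp, h⟩ := hne
    exact ⟨_, _, hnorm p hp h, rfl⟩
  set m := sInf Q with hm
  have hlow : ∀ p ∈ S, m * ‖p.1‖ ^ 2 ≤ q p := by
    intro p hp
    by_cases h : p.1 = 0
    · simpa [h] using hq0 p
    have h1 : m ≤ q (‖p.1‖⁻¹ • p) := csInf_le hbdd ⟨_, hnorm p hp h, rfl⟩
    have h2 : 0 < ‖p.1‖ := norm_pos_iff.2 h
    rw [hqs] at h1
    calc m * ‖p.1‖ ^ 2 ≤ (‖p.1‖⁻¹ ^ 2 * q p) * ‖p.1‖ ^ 2 := by gcongr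
      _ = q p := by field_simp
  have hm0 : 0 ≤ m := le_csInf hQne (by rintro _ ⟨p, -, rfl⟩; exact hq0 p)
  have hex : ∀ n : ℕ, ∃ p, p ∈ S ∧ ‖p.1‖ = 1 ∧ q p < m + 1 / ((n : ℝ) + 1) := by
    intro n
    obtain ⟨_, ⟨p, hp, rfl⟩, h⟩ := exists_lt_of_csInf_lt hQne
      (show sInf Q < m + 1 / ((n : ℝ) + 1) by rw [← hm]; linarith [Nat.one_div_pos_of_nat (α := ℝ) (n := n)])
    exact ⟨p, hp.1, hp.2, h⟩
  choose p hpS hp1 hpq using hex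
  -- Along an ultrafilter every bounded sequence of reals converges, so no subsequences are needed.
  set 𝒰 : Ultrafilter ℕ := hyperfilter ℕ
  have hU : (𝒰 : Filter ℕ) ≤ atTop := by
    rw [← Nat.cofinite_eq_atTop]; exact hyperfilter_le_cofinite
  have hqlim : Tendsto (fun n => q (p n)) 𝒰 (𝓝 m) := by
    refine Tendsto.mono_left ?_ hU
    refine tendsto_of_tendsto_of_tendsto_of_le_of_le tendsto_const_nhds
      (by simpa using (tendsto_one_div_add_atTop_nhds_zero_nat (𝕜 := ℝ)).const_add m)
      (fun n => ?_) (fun n => (hpq n).le)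
    simpa [hp1 n] using hlow _ (hpS n)
  have hpara : ∀ a b : H × H × H, q (a - b) = 2 * q a + 2 * q b - q (a + b) := by
    intro a b
    have h1 := parallelogram_law_with_norm ℝ a.2.1 b.2.1
    have h2 := parallelogram_law_with_norm ℝ a.2.2 b.2.2
    simp only [hq, Prod.snd_sub, Prod.fst_sub, Prod.snd_add, Prod.fst_add]
    linarith
  have hucauchy : ∀ ε : ℝ, 0 < ε → ∃ A ∈ 𝒰, ∀ i ∈ A, ∀ j ∈ A, ‖(p i).1 - (p j).1‖ ^ 2 ≤ ε := by
    intro ε hε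
    obtain ⟨ι, _, χ, hχ⟩ := hcpt (ε / (8 * (m + 1))) (by positivity)
    set n : ℕ := Fintype.card ι
    have hlim : ∀ k, ∃ c, Tendsto (fun i => inner ℝ (χ k) (p i).1) 𝒰 (𝓝 c) := by
      intro k
      have hc : IsCompact (Set.Icc (-‖χ k‖) ‖χ k‖) := isCompact_Icc
      obtain ⟨c, -, h⟩ := hc.ultrafilter_le_nhds (𝒰.map fun i => inner ℝ (χ k) (p i).1) (by
        refine le_principal_iff.2 (mem_map.2 (univ_mem' fun i => abs_le.1 ?_))
        simpa [hp1 i] using abs_real_inner_le_norm (χ k) (p i).1)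
      exact ⟨c, h⟩
    choose c hc using hlim
    set η : ℝ := √(ε / (8 * (n + 1))) with hη
    have hη0 : 0 < η := Real.sqrt_pos.2 (by positivity)
    have h1 : ∀ᶠ i in (𝒰 : Filter ℕ), ∀ k, |inner ℝ (χ k) (p i).1 - c k| < η := by
      rw [eventually_all]
      intro k
      exact (hc k).eventually (Metric.ball_mem_nhds (c k) hη0)
    have h2 : ∀ᶠ i in (𝒰 : Filter ℕ), q (p i) < m + 1 :=
      hqlim.eventually (gt_mem_nhds (by linarith))
    refine ⟨_, h1.and h2, ?_⟩
    rintro i ⟨hi1, hi2⟩ j ⟨hj1, hj2⟩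
    have h3 := hχ (p i - p j) (S.sub_mem (hpS i) (hpS j))
    have h4 : q (p i - p j) ≤ 4 * (m + 1) := by
      rw [hpara]; linarith [hq0 (p i + p j)]
    have h5 : ∑ k, inner ℝ (χ k) (p i - p j).1 ^ 2 ≤ ε / 2 := by
      calc _ ≤ ∑ k : ι, 4 * η ^ 2 := by
            refine Finset.sum_le_sum fun k _ => ?_
            have e : inner ℝ (χ k) (p i - p j).1 = (inner ℝ (χ k) (p i).1 - c k) -
                (inner ℝ (χ k) (p j).1 - c k) := by
              rw [Prod.fst_sub, inner_sub_right]; ring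
            have := (abs_sub (inner ℝ (χ k) (p i).1 - c k) (inner ℝ (χ k) (p j).1 - c k)).trans
              (add_le_add (hi1 k).le (hj1 k).le)
            rw [e, ← sq_abs]
            calc _ ≤ (η + η) ^ 2 := by gcongr
              _ = _ := by ring
        _ = n * (ε / (2 * (n + 1))) := by
            rw [Finset.sum_const, Finset.card_univ, nsmul_eq_mul, hη,
              Real.sq_sqrt (by positivity)]
            field_simp; ring
        _ ≤ ε / 2 := by
            rw [mul_div_assoc', div_le_div_iff₀ (by positivity) (by positivity)]
            nlinarith
    calc ‖(p i).1 - (p j).1‖ ^ 2 = ‖(p i - p j).1‖ ^ 2 := by rw [Prod.fst_sub]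
      _ ≤ _ := h3
      _ ≤ ε / (8 * (m + 1)) * (4 * (m + 1)) + ε / 2 := add_le_add (by gcongr) h5
      _ = ε := by field_simp; ring
  -- By the parallelogram law, the gradients of a minimizing sequence are Cauchy once the vectors are.
  have hwcauchy : ∀ ε : ℝ, 0 < ε → ∃ A ∈ 𝒰, ∀ i ∈ A, ∀ j ∈ A,
      ‖(p i).1 - (p j).1‖ ^ 2 ≤ ε ∧ q (p i - p j) ≤ ε := by
    intro ε hε
    obtain ⟨A, hA, h⟩ := hucauchy (ε / (2 * (m + 1))) (by positivity)
    have h2 : ∀ᶠ i in (𝒰 : Filter ℕ), q (p i) < m + ε / 8 :=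
      hqlim.eventually (gt_mem_nhds (by linarith))
    refine ⟨_, inter_mem hA h2, ?_⟩
    rintro i ⟨hi1, hi2⟩ j ⟨hj1, hj2⟩
    have h3 := h i hi1 j hj1
    have h5 : ε / (2 * (m + 1)) ≤ ε / 2 := by gcongr; linarith
    refine ⟨by linarith, ?_⟩
    have h4 := hlow (p i + p j) (S.add_mem (hpS i) (hpS j))
    have h6 := parallelogram_law_with_norm ℝ (p i).1 (p j).1
    rw [Prod.fst_add] at h4
    rw [hp1, hp1] at h6
    have h7 : m * ‖(p i).1 - (p j).1‖ ^ 2 ≤ ε / 2 := by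
      calc _ ≤ m * (ε / (2 * (m + 1))) := by gcongr
        _ ≤ _ := by
          rw [mul_div_assoc', div_le_div_iff₀ (by positivity) (by positivity)]
          nlinarith
    have h8 : ‖(p i).1 + (p j).1‖ ^ 2 = 4 - ‖(p i).1 - (p j).1‖ ^ 2 := by linarith
    rw [hpara]
    rw [h8] at h4
    simp only [Set.mem_ofPred_eq] at hi2 hj2
    linarith
  have hcau : Cauchy ((𝒰 : Filter ℕ).map p) := by
    refine Metric.cauchy_iff.2 ⟨inferInstance, fun ε hε => ?_⟩
    obtain ⟨A, hA, h⟩ := hwcauchy ((ε / 2) ^ 2) (by positivity)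
    refine ⟨p '' A, image_mem_map hA, ?_⟩
    rintro _ ⟨i, hi, rfl⟩ _ ⟨j, hj, rfl⟩
    obtain ⟨h1, h2⟩ := h i hi j hj
    have h3 : ‖(p i - p j).2.1‖ ^ 2 ≤ (ε / 2) ^ 2 := (le_add_of_nonneg_right (by positivity)).trans h2
    have h4 : ‖(p i - p j).2.2‖ ^ 2 ≤ (ε / 2) ^ 2 := (le_add_of_nonneg_left (by positivity)).trans h2
    rw [← Prod.fst_sub] at h1
    rw [dist_eq_norm]
    refine lt_of_le_of_lt ?_ (half_lt_self hε)
    refine norm_prod_le_iff.2 ⟨?_, norm_prod_le_iff.2 ⟨?_, ?_⟩⟩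
    all_goals exact abs_le_of_sq_le_sq' (by assumption) (by positivity) |>.2
  obtain ⟨P, hP⟩ := CompleteSpace.complete hcau
  have hPt : Tendsto p 𝒰 (𝓝 P) := hP
  have hPS : P ∈ S := hS.mem_of_tendsto hPt (Eventually.of_forall hpS)
  have hP1 : ‖P.1‖ = 1 := by
    have h1 : Tendsto (fun i => ‖(p i).1‖) 𝒰 (𝓝 ‖P.1‖) :=
      ((continuous_fst.norm).tendsto P).comp hPt
    simp_rw [hp1] at h1
    exact tendsto_nhds_unique h1 tendsto_const_nhds
  have hPq : q P = m := by
    have hqc : Continuous q := by fun_prop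
    exact tendsto_nhds_unique ((hqc.tendsto P).comp hPt) hqlim
  refine ⟨P, hPS, m, norm_ne_zero_iff.1 (by rw [hP1]; norm_num), fun z hz => ?_⟩
  -- The first variation at the minimizer vanishes.
  set β := inner ℝ P.2.1 z.2.1 + inner ℝ P.2.2 z.2.2 - m * inner ℝ P.1 z.1 with hβ
  have hvar : ∀ s : ℝ, 0 ≤ (q z - m * ‖z.1‖ ^ 2) * (s * s) + (2 * β) * s + 0 := by
    intro s
    have h1 := hlow (P + s • z) (S.add_mem hPS (S.smul_mem s hz))
    have h2 : m * ‖P.1‖ ^ 2 = q P := by rw [hP1, hPq]; ring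
    simp only [hq, Prod.fst_add, Prod.snd_add, Prod.smul_fst, Prod.smul_snd, norm_add_sq_real,
      inner_smul_right, norm_smul, mul_pow, Real.norm_eq_abs, sq_abs] at h1 h2 ⊢
    rw [hβ]
    nlinarith
  have hd := discrim_le_zero hvar
  have hβ0 : β = 0 := by
    unfold discrim at hd
    nlinarith [sq_nonneg β]
  rw [real_inner_smul_left]
  linarith

/-- The smooth triples form a linear subspace. -/
noncomputable def smoothSubmodule (D Γ : Set (ℝ × ℝ)) : Submodule ℝ (L2 D × L2 D × L2 D) where
  carrier := smoothTriples D Γ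
  zero_mem' := by
    refine ⟨0, contDiff_const, by simp, ?_, ?_, ?_⟩
    · exact Lp.coeFn_zero _ _ _
    · exact (Lp.coeFn_zero _ _ _).trans (.of_eq (by ext x; simp))
    · exact (Lp.coeFn_zero _ _ _).trans (.of_eq (by ext x; simp))
  add_mem' := by
    rintro p p' ⟨φ, hφ, hd, h0, h1, h2⟩ ⟨φ', hφ', hd', h0', h1', h2'⟩
    have hfd : ∀ x v, fderiv ℝ (φ + φ') x v = fderiv ℝ φ x v + fderiv ℝ φ' x v := fun x v => by
      rw [fderiv_add (hφ.differentiable (by simp) x) (hφ'.differentiable (by simp) x)]; rfl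
    refine ⟨φ + φ', hφ.add hφ', ?_, ?_, ?_, ?_⟩
    · exact (hd.sup_left hd').mono_left (tsupport_add φ φ')
    · exact (Lp.coeFn_add _ _).trans (h0.add h0')
    · refine (Lp.coeFn_add _ _).trans ((h1.add h1').trans (.of_eq ?_))
      ext x; simp [hfd]
    · refine (Lp.coeFn_add _ _).trans ((h2.add h2').trans (.of_eq ?_))
      ext x; simp [hfd]
  smul_mem' := by
    rintro c p ⟨φ, hφ, hd, h0, h1, h2⟩
    have hfd : ∀ x v, fderiv ℝ (c • φ) x v = c • fderiv ℝ φ x v := fun x v => by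
      rw [fderiv_const_smul (hφ.differentiable (by simp) x)]; rfl
    refine ⟨c • φ, hφ.const_smul c, ?_, ?_, ?_, ?_⟩
    · exact hd.mono_left (closure_mono (Function.support_const_smul_subset c φ))
    · exact (Lp.coeFn_smul _ _).trans (h0.const_smul c)
    · refine (Lp.coeFn_smul _ _).trans ((h1.const_smul c).trans (.of_eq ?_))
      ext x; simp [hfd]
    · refine (Lp.coeFn_smul _ _).trans ((h2.const_smul c).trans (.of_eq ?_))
      ext x; simp [hfd]

/-- A lower bound for the form on smooth functions, together with the compactness of the embedding
of the form domain, bounds the lowest eigenvalue from below.  Compactness is needed because the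
infimum of an empty set of eigenvalues would be `0`. -/
theorem le_sInf_isEigenvalue {D Γ : Set (ℝ × ℝ)} {Λ : ℝ}
    (hlow : ∀ p ∈ smoothTriples D Γ, Λ * ‖p.1‖ ^ 2 ≤ ‖p.2.1‖ ^ 2 + ‖p.2.2‖ ^ 2)
    (hcpt : ∀ ε : ℝ, 0 < ε → ∃ (ι : Type) (_ : Fintype ι) (χ : ι → L2 D), ∀ p ∈ smoothTriples D Γ,
      ‖p.1‖ ^ 2 ≤ ε * (‖p.2.1‖ ^ 2 + ‖p.2.2‖ ^ 2) + ∑ i, inner ℝ (χ i) p.1 ^ 2)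
    (hne : ∃ p ∈ smoothTriples D Γ, p.1 ≠ 0) :
    Λ ≤ sInf {E | IsEigenvalue D Γ E} := by
  set S := (smoothSubmodule D Γ).topologicalClosure with hS
  have hSmem : ∀ p, p ∈ S ↔ p ∈ formDomain D Γ := fun p => Iff.rfl
  refine le_csInf ?_ ?_
  · obtain ⟨p, hp, E, hp0, h⟩ := exists_minimizer S (Submodule.isClosed_topologicalClosure _)
      (by
        intro ε hε
        obtain ⟨ι, hι, χ, h⟩ := hcpt ε hε
        refine ⟨ι, hι, χ, fun p hp => ?_⟩
        exact le_on_closure (fun p hp => h p hp) (Continuous.continuousOn (by fun_prop))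
          (Continuous.continuousOn (by fun_prop)) hp)
      (by
        obtain ⟨p, hp, h⟩ := hne
        exact ⟨p, subset_closure hp, h⟩)
    exact ⟨E, p.1, hp0, p.2.1, p.2.2, hp, fun v z₁ z₂ hz => h (v, z₁, z₂) hz⟩
  · rintro E ⟨u, hu, w₁, w₂, hmem, h⟩
    have h1 : Λ * ‖u‖ ^ 2 ≤ ‖w₁‖ ^ 2 + ‖w₂‖ ^ 2 :=
      le_on_closure (s := smoothTriples D Γ) (f := fun p => Λ * ‖p.1‖ ^ 2)
        (g := fun p => ‖p.2.1‖ ^ 2 + ‖p.2.2‖ ^ 2) hlow (Continuous.continuousOn (by fun_prop))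
        (Continuous.continuousOn (by fun_prop)) hmem
    have h2 := h u w₁ w₂ hmem
    rw [real_inner_smul_left, real_inner_self_eq_norm_sq, real_inner_self_eq_norm_sq,
      real_inner_self_eq_norm_sq] at h2
    have h3 : 0 < ‖u‖ ^ 2 := by positivity
    exact le_of_mul_le_mul_right (h1.trans_eq h2) h3

/-! ### Strips over a graph -/

/-- The Poincaré inequality on each of `n` equal subintervals, added up. -/
theorem poincare_partition {f f' : ℝ → ℝ} (hf : ∀ x, HasDerivAt f (f' x) x)
    (hf' : Continuous f') {L : ℝ} (hL : 0 < L) {n : ℕ} (hn : 0 < n) :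
    ∫ x in (0 : ℝ)..L, f x ^ 2 ≤
      ∑ i ∈ Finset.range n, (L / n)⁻¹ * (∫ x in (i * (L / n))..((i + 1 : ℕ) * (L / n)), f x) ^ 2 +
        (L / n) ^ 2 * ∫ x in (0 : ℝ)..L, f' x ^ 2 := by
  have hfc : Continuous f := continuous_iff_continuousAt.2 fun x => (hf x).continuousAt
  have hn' : (0 : ℝ) < n := by exact_mod_cast hn
  have split : ∀ h : ℝ → ℝ, Continuous h → ∫ x in (0 : ℝ)..L, h x =
      ∑ i ∈ Finset.range n, ∫ x in (i * (L / n))..((i + 1 : ℕ) * (L / n)), h x := by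
    intro h hh
    rw [intervalIntegral.sum_integral_adjacent_intervals (a := fun i : ℕ => (i : ℝ) * (L / n))
      fun k _ => hh.intervalIntegrable _ _]
    congr 1
    · simp
    · field_simp
  rw [split _ (by fun_prop : Continuous fun x => f x ^ 2),
    split _ (by fun_prop : Continuous fun x => f' x ^ 2), Finset.mul_sum, ← Finset.sum_add_distrib]
  refine Finset.sum_le_sum fun i _ => ?_
  have hd : ((i + 1 : ℕ) : ℝ) * (L / n) - i * (L / n) = L / n := by push_cast; ring
  have := poincare_interval hf hf' (a := i * (L / n)) (b := (i + 1 : ℕ) * (L / n))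
    (by rw [← sub_pos, hd]; positivity)
  rwa [hd] at this

/-- A Rellich type estimate: up to a small multiple of the gradient, the `L₂` norm on a rectangle is
controlled by the mean values over the cells of an `n × n` grid. -/
theorem grid_estimate {F Fx Fy : ℝ → ℝ → ℝ} (cF : Continuous fun p : ℝ × ℝ => F p.1 p.2)
    (cFx : Continuous fun p : ℝ × ℝ => Fx p.1 p.2) (cFy : Continuous fun p : ℝ × ℝ => Fy p.1 p.2)
    (dx : ∀ x y, HasDerivAt (fun x => F x y) (Fx x y) x) (dy : ∀ x y, HasDerivAt (F x) (Fy x y) y)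
    {L W : ℝ} (hL : 0 < L) (hW : 0 < W) {n : ℕ} (hn : 0 < n) :
    ∫ x in (0 : ℝ)..L, ∫ y in (0 : ℝ)..W, F x y ^ 2 ≤
      ∑ j ∈ Finset.range n, ∑ i ∈ Finset.range n, (W / n)⁻¹ * (L / n)⁻¹ *
        (∫ x in (i * (L / n))..((i + 1 : ℕ) * (L / n)),
          ∫ y in (j * (W / n))..((j + 1 : ℕ) * (W / n)), F x y) ^ 2 +
      (L / n) ^ 2 * (∫ x in (0 : ℝ)..L, ∫ y in (0 : ℝ)..W, Fx x y ^ 2) +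
      (W / n) ^ 2 * ∫ x in (0 : ℝ)..L, ∫ y in (0 : ℝ)..W, Fy x y ^ 2 := by
  have hn' : (0 : ℝ) < n := by exact_mod_cast hn
  set h := W / n with hh
  have hpos : 0 < h := by positivity
  set A : ℕ → ℝ → ℝ := fun j x => ∫ y in (j * h)..((j + 1 : ℕ) * h), F x y with hA
  set A' : ℕ → ℝ → ℝ := fun j x => ∫ y in (j * h)..((j + 1 : ℕ) * h), Fx x y with hA'
  have cFi : ∀ x, Continuous (F x) := fun x => cF.comp (by fun_prop : Continuous fun y => (x, y))
  have cFxi : ∀ x, Continuous (Fx x) := fun x => cFx.comp (by fun_prop : Continuous fun y => (x, y))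
  have cFyi : ∀ x, Continuous (Fy x) := fun x => cFy.comp (by fun_prop : Continuous fun y => (x, y))
  have cA : ∀ j, Continuous (A j) := fun j => continuous_fibre_integral cF _ _
  have cA' : ∀ j, Continuous (A' j) := fun j => continuous_fibre_integral cFx _ _
  have dA : ∀ j x, HasDerivAt (A j) (A' j x) x := fun j x => hasDerivAt_integral_param cF cFx dx _ _ _
  have cX : Continuous fun x => ∫ y in (0 : ℝ)..W, Fx x y ^ 2 :=
    continuous_fibre_integral (H := fun x y => Fx x y ^ 2) (by fun_prop) _ _
  have cY : Continuous fun x => ∫ y in (0 : ℝ)..W, Fy x y ^ 2 :=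
    continuous_fibre_integral (H := fun x y => Fy x y ^ 2) (by fun_prop) _ _
  have cT : Continuous fun x => ∫ y in (0 : ℝ)..W, F x y ^ 2 :=
    continuous_fibre_integral (H := fun x y => F x y ^ 2) (by fun_prop) _ _
  have step1 : ∫ x in (0 : ℝ)..L, ∫ y in (0 : ℝ)..W, F x y ^ 2 ≤
      ∑ j ∈ Finset.range n, h⁻¹ * (∫ x in (0 : ℝ)..L, A j x ^ 2) +
        h ^ 2 * ∫ x in (0 : ℝ)..L, ∫ y in (0 : ℝ)..W, Fy x y ^ 2 := by
    calc _ ≤ ∫ x in (0 : ℝ)..L, (∑ j ∈ Finset.range n, h⁻¹ * A j x ^ 2 +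
          h ^ 2 * ∫ y in (0 : ℝ)..W, Fy x y ^ 2) := by
          refine intervalIntegral.integral_mono_on hL.le (cT.intervalIntegrable _ _)
            (Continuous.intervalIntegrable (by fun_prop) _ _) fun x _ => ?_
          exact poincare_partition (dy x) (cFyi x) hW hn
      _ = _ := by
          rw [intervalIntegral.integral_add (Continuous.intervalIntegrable (by fun_prop) _ _)
            (Continuous.intervalIntegrable (by fun_prop) _ _),
            intervalIntegral.integral_finsetSum
              fun j _ => Continuous.intervalIntegrable (by fun_prop) _ _]
          simp_rw [intervalIntegral.integral_const_mul]
  have step2 : ∀ x, ∑ j ∈ Finset.range n, A' j x ^ 2 ≤ h * ∫ y in (0 : ℝ)..W, Fx x y ^ 2 := by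
    intro x
    have hs : ∫ y in (0 : ℝ)..W, Fx x y ^ 2 =
        ∑ j ∈ Finset.range n, ∫ y in (j * h)..((j + 1 : ℕ) * h), Fx x y ^ 2 := by
      rw [intervalIntegral.sum_integral_adjacent_intervals (a := fun i : ℕ => (i : ℝ) * h)
        fun k _ => Continuous.intervalIntegrable (by fun_prop) _ _]
      congr 1
      · simp
      · rw [hh]; field_simp
    rw [hs, Finset.mul_sum]
    refine Finset.sum_le_sum fun j _ => ?_
    have hd : ((j + 1 : ℕ) : ℝ) * h - j * h = h := by push_cast; ring
    have := sq_integral_le (cFxi x) (a := j * h) (b := (j + 1 : ℕ) * h) (by linarith)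
    rwa [hd] at this
  have step3 : ∑ j ∈ Finset.range n, ∫ x in (0 : ℝ)..L, A' j x ^ 2 ≤
      h * ∫ x in (0 : ℝ)..L, ∫ y in (0 : ℝ)..W, Fx x y ^ 2 := by
    rw [← intervalIntegral.integral_finsetSum
      fun j _ => Continuous.intervalIntegrable (by fun_prop) _ _,
      ← intervalIntegral.integral_const_mul]
    exact intervalIntegral.integral_mono_on hL.le (Continuous.intervalIntegrable (by fun_prop) _ _)
      (Continuous.intervalIntegrable (by fun_prop) _ _) fun x _ => step2 x
  have step4 : ∑ j ∈ Finset.range n, h⁻¹ * (∫ x in (0 : ℝ)..L, A j x ^ 2) ≤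
      ∑ j ∈ Finset.range n, (∑ i ∈ Finset.range n, h⁻¹ * (L / n)⁻¹ *
        (∫ x in (i * (L / n))..((i + 1 : ℕ) * (L / n)), A j x) ^ 2 +
        h⁻¹ * (L / n) ^ 2 * ∫ x in (0 : ℝ)..L, A' j x ^ 2) := by
    refine Finset.sum_le_sum fun j _ => ?_
    have := mul_le_mul_of_nonneg_left (poincare_partition (dA j) (cA' j) hL hn) (inv_nonneg.2 hpos.le)
    rw [mul_add, Finset.mul_sum] at this
    refine this.trans_eq ?_
    simp_rw [mul_assoc]
  have step5 : ∑ j ∈ Finset.range n, h⁻¹ * (L / n) ^ 2 * ∫ x in (0 : ℝ)..L, A' j x ^ 2 ≤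
      (L / n) ^ 2 * ∫ x in (0 : ℝ)..L, ∫ y in (0 : ℝ)..W, Fx x y ^ 2 := by
    rw [← Finset.mul_sum]
    calc _ ≤ h⁻¹ * (L / n) ^ 2 * (h * ∫ x in (0 : ℝ)..L, ∫ y in (0 : ℝ)..W, Fx x y ^ 2) := by gcongr
      _ = _ := by field_simp
  rw [Finset.sum_add_distrib] at step4
  linarith

/-- The domain of width `π` above the graph of `G` over `(0, L)`. -/
def graphStrip (L : ℝ) (G : ℝ → ℝ) : Set (ℝ × ℝ) :=
  {x | 0 < x.1 ∧ x.1 < L ∧ G x.1 < x.2 ∧ x.2 < G x.1 + Real.pi}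

/-- The two curved sides of `graphStrip L G`. -/
def graphWall (L : ℝ) (G : ℝ → ℝ) : Set (ℝ × ℝ) :=
  {x | 0 < x.1 ∧ x.1 < L ∧ x.2 = G x.1} ∪ {x | 0 < x.1 ∧ x.1 < L ∧ x.2 = G x.1 + Real.pi}

/-- The shear that straightens `graphStrip L G` to a rectangle. -/
def shear (G : ℝ → ℝ) (hG : Continuous G) : (ℝ × ℝ) ≃ₜ (ℝ × ℝ) where
  toFun p := (p.1, p.2 + G p.1)
  invFun p := (p.1, p.2 - G p.1)
  left_inv p := by simp
  right_inv p := by simp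
  continuous_toFun := by fun_prop
  continuous_invFun := by fun_prop

theorem measurePreserving_shear {G : ℝ → ℝ} (hG : Continuous G) :
    MeasurePreserving (shear G hG) := by
  refine (MeasurePreserving.id (volume : Measure ℝ)).skew_product (g := fun x y => y + G x)
    (by have := hG.measurable; fun_prop) (Filter.Eventually.of_forall fun x => ?_)
  exact map_add_right_eq_self volume (G x)

theorem setIntegral_image_shear {G : ℝ → ℝ} (hG : Continuous G) {H : ℝ × ℝ → ℝ} (hH : Continuous H)
    {a b c d : ℝ} (hab : a ≤ b) (hcd : c ≤ d) :
    ∫ p in shear G hG '' (Set.Ioo a b ×ˢ Set.Ioo c d), H p =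
      ∫ x in a..b, ∫ y in c..d, H (x, y + G x) := by
  have hcomp : Continuous (H ∘ shear G hG) := hH.comp (shear G hG).continuous
  rw [(measurePreserving_shear hG).setIntegral_image_emb (shear G hG).measurableEmbedding]
  have hint : IntegrableOn (H ∘ shear G hG) (Set.Ioo a b ×ˢ Set.Ioo c d)
      ((volume : Measure ℝ).prod volume) :=
    (hcomp.continuousOn.integrableOn_compact (isCompact_Icc.prod isCompact_Icc)).mono_set
      (Set.prod_mono Set.Ioo_subset_Icc_self Set.Ioo_subset_Icc_self)
  rw [intervalIntegral.integral_of_le hab, integral_Ioc_eq_integral_Ioo]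
  simp_rw [intervalIntegral.integral_of_le hcd, integral_Ioc_eq_integral_Ioo]
  exact setIntegral_prod (fun p => H (shear G hG p)) hint

theorem graphStrip_eq_image (L : ℝ) {G : ℝ → ℝ} (hG : Continuous G) :
    graphStrip L G = shear G hG '' (Set.Ioo 0 L ×ˢ Set.Ioo 0 Real.pi) := by
  rw [Homeomorph.image_eq_preimage_symm]
  ext p
  simp only [graphStrip, shear, Set.mem_preimage, Set.mem_prod, Set.mem_Ioo, Set.mem_ofPred_eq,
    Homeomorph.homeomorph_mk_coe_symm, Equiv.coe_fn_symm_mk]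
  constructor
  · rintro ⟨h1, h2, h3, h4⟩
    exact ⟨⟨h1, h2⟩, by linarith, by linarith⟩
  · rintro ⟨⟨h1, h2⟩, h3, h4⟩
    exact ⟨h1, h2, by linarith, by linarith⟩

theorem isOpen_graphStrip (L : ℝ) {G : ℝ → ℝ} (hG : Continuous G) : IsOpen (graphStrip L G) := by
  rw [graphStrip_eq_image L hG]
  exact (shear G hG).isOpenMap _ (isOpen_Ioo.prod isOpen_Ioo)

theorem norm_sq_eq_integral {D : Set (ℝ × ℝ)} (u : L2 D) {φ : ℝ × ℝ → ℝ}
    (h : u =ᵐ[volume.restrict D] φ) : ‖u‖ ^ 2 = ∫ p in D, φ p ^ 2 := by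
  rw [← real_inner_self_eq_norm_sq, L2.inner_def]
  refine integral_congr_ae ?_
  filter_upwards [h] with p hp
  rw [hp]
  simp [sq]

/-- A smooth function vanishing near the walls, in straightened coordinates. -/
theorem isStripFunction_comp_shear {L : ℝ} {G G' : ℝ → ℝ} (hG : ∀ x, HasDerivAt G (G' x) x)
    (hG' : Continuous G') {φ : ℝ × ℝ → ℝ} (hφ : ContDiff ℝ 1 φ) (hL : 0 < L)
    (hdisj : Disjoint (tsupport φ) (closure (graphWall L G))) :
    IsStripFunction L (fun x y => φ (x, y + G x))
      (fun x y => fderiv ℝ φ (x, y + G x) (1, 0) + G' x * fderiv ℝ φ (x, y + G x) (0, 1))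
      (fun x y => fderiv ℝ φ (x, y + G x) (0, 1)) := by
  have hGc : Continuous G := continuous_iff_continuousAt.2 fun x => (hG x).continuousAt
  have hφc := hφ.continuous
  have hfd : Continuous (fderiv ℝ φ) := hφ.continuous_fderiv (by norm_num)
  have hdiff : ∀ p, HasFDerivAt φ (fderiv ℝ φ p) p := fun p =>
    (hφ.differentiable (by norm_num) p).hasFDerivAt
  have hvan : ∀ c : ℝ, (fun x => (x, G x + c)) '' Set.Ioo 0 L ⊆ graphWall L G →
      ∀ x ∈ Set.Icc 0 L, ∀ᶠ y in nhds c, φ (x, y + G x) = 0 := by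
    intro c hc x hx
    have hcl : (x, G x + c) ∈ closure (graphWall L G) := by
      refine closure_mono hc (image_closure_subset_closure_image (by fun_prop) ⟨x, ?_, rfl⟩)
      rwa [closure_Ioo hL.ne]
    have hnot : (x, G x + c) ∉ tsupport φ := fun h => Set.disjoint_left.1 hdisj h hcl
    have ht : Filter.Tendsto (fun y => (x, y + G x)) (nhds c) (nhds (x, G x + c)) := by
      rw [add_comm (G x)]
      exact Continuous.tendsto (by fun_prop) c
    exact ht.eventually (notMem_tsupport_iff_eventuallyEq.1 hnot)
  refine ⟨by fun_prop, by fun_prop, by fun_prop, fun x y => ?_, fun x y => ?_, hvan 0 ?_,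
    hvan Real.pi ?_⟩
  · have h1 : HasDerivAt (fun x => (x, y + G x)) ((1 : ℝ), G' x) x :=
      (hasDerivAt_id x).prodMk ((hG x).const_add y)
    refine ((hdiff (x, y + G x)).comp_hasDerivAt x h1).congr_deriv ?_
    have : ((1 : ℝ), G' x) = (1, 0) + G' x • (0, 1) := by simp
    rw [this, map_add, map_smul, smul_eq_mul]
  · have h1 : HasDerivAt (fun y => (x, y + G x)) ((0 : ℝ), (1 : ℝ)) y :=
      (hasDerivAt_const y x).prodMk ((hasDerivAt_id y).add_const (G x))
    exact (hdiff (x, y + G x)).comp_hasDerivAt y h1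
  · rintro _ ⟨x, hx, rfl⟩
    exact Or.inl ⟨hx.1, hx.2, add_zero _⟩
  · rintro _ ⟨x, hx, rfl⟩
    exact Or.inr ⟨hx.1, hx.2, rfl⟩

/-- The form domain is nontrivial: it contains a bump function supported in the open strip. -/
theorem exists_smoothTriple_ne_zero {L : ℝ} (hL : 0 < L) {G : ℝ → ℝ} (hG : Continuous G) :
    ∃ p ∈ smoothTriples (graphStrip L G) (graphWall L G), p.1 ≠ 0 := by
  have hopen := isOpen_graphStrip L hG
  have hpi := Real.pi_pos
  have hmem : (L / 2, G (L / 2) + Real.pi / 2) ∈ graphStrip L G :=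
    ⟨by simpa, by simpa, by simpa, by simpa⟩
  obtain ⟨φ, hsupp, hcpt, hsm, -, h1⟩ := exists_contDiff_tsupport_subset (n := ⊤) (hopen.mem_nhds hmem)
  have hφ : ContDiff ℝ ((⊤ : ℕ∞) : WithTop ℕ∞) φ := hsm
  have hd : Continuous (fderiv ℝ φ) := hφ.continuous_fderiv (by simp)
  have m0 : MemLp φ 2 (volume.restrict (graphStrip L G)) :=
    (hφ.continuous.memLp_of_hasCompactSupport hcpt).restrict _
  have m1 : ∀ v, MemLp (fun x => fderiv ℝ φ x v) 2 (volume.restrict (graphStrip L G)) := fun v =>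
    (Continuous.memLp_of_hasCompactSupport (by fun_prop) (hcpt.fderiv_apply (𝕜 := ℝ) v)).restrict _
  refine ⟨(m0.toLp _, (m1 (1, 0)).toLp _, (m1 (0, 1)).toLp _),
    ⟨φ, hφ, ?_, m0.coeFn_toLp, (m1 _).coeFn_toLp, (m1 _).coeFn_toLp⟩, ?_⟩
  · refine Set.disjoint_of_subset_left hsupp (Disjoint.closure_right ?_ hopen)
    rw [Set.disjoint_left]
    rintro p ⟨-, -, h3, h4⟩ (⟨-, -, h⟩ | ⟨-, -, h⟩)
    · exact absurd h h3.ne'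
    · exact absurd h h4.ne
  · intro h0
    have hae : φ =ᵐ[volume.restrict (graphStrip L G)] 0 :=
      m0.coeFn_toLp.symm.trans ((Lp.eq_zero_iff_ae_eq_zero).1 h0)
    have heq : Set.EqOn φ 0 (graphStrip L G) :=
      Measure.eqOn_open_of_ae_eq hae hopen hφ.continuous.continuousOn continuousOn_const
    have := heq hmem
    simp [h1] at this

/-- A bound of the mass by the energy excess in straightened coordinates is a spectral gap above
the threshold `1` for the waveguide. -/
theorem le_sInf_isEigenvalue_graphStrip {L : ℝ} (hL : 0 < L) {G G' : ℝ → ℝ}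
    (hG : ∀ x, HasDerivAt G (G' x) x) (hG' : Continuous G') {M : ℝ} (hM : 0 < M)
    (h : ∀ F Fx Fy, IsStripFunction L F Fx Fy →
      ∫ x in (0 : ℝ)..L, ∫ y in (0 : ℝ)..Real.pi, F x y ^ 2 ≤
        M * ∫ x in (0 : ℝ)..L, excess F Fx Fy G' x) :
    1 + M⁻¹ ≤ sInf {E | IsEigenvalue (graphStrip L G) (graphWall L G) E} := by
  have hGc : Continuous G := continuous_iff_continuousAt.2 fun x => (hG x).continuousAt
  have hpi := Real.pi_pos
  have hint : ∀ H : ℝ × ℝ → ℝ, Continuous H → ∫ p in graphStrip L G, H p =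
      ∫ x in (0 : ℝ)..L, ∫ y in (0 : ℝ)..Real.pi, H (x, y + G x) := fun H hH => by
    rw [graphStrip_eq_image L hGc, setIntegral_image_shear hGc hH hL.le hpi.le]
  refine le_sInf_isEigenvalue ?_ ?_ (exists_smoothTriple_ne_zero hL hGc)
  · rintro p ⟨φ, hφ, hdisj, h0, h1, h2⟩
    have hφc := hφ.continuous
    have hfd : Continuous (fderiv ℝ φ) := hφ.continuous_fderiv (by simp)
    have S := isStripFunction_comp_shear hG hG' (hφ.of_le (by exact_mod_cast le_top)) hL hdisj
    have key := h _ _ _ S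
    rw [norm_sq_eq_integral _ h0, norm_sq_eq_integral _ h1, norm_sq_eq_integral _ h2,
      hint _ (by fun_prop), hint _ (by fun_prop), hint _ (by fun_prop)]
    have c0 : Continuous fun x => ∫ y in (0 : ℝ)..Real.pi, φ (x, y + G x) ^ 2 :=
      continuous_fibre_integral (H := fun x y => φ (x, y + G x) ^ 2) (by fun_prop) _ _
    have c1 : Continuous fun x => ∫ y in (0 : ℝ)..Real.pi, fderiv ℝ φ (x, y + G x) (1, 0) ^ 2 :=
      continuous_fibre_integral (H := fun x y => fderiv ℝ φ (x, y + G x) (1, 0) ^ 2) (by fun_prop) _ _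
    have c2 : Continuous fun x => ∫ y in (0 : ℝ)..Real.pi, fderiv ℝ φ (x, y + G x) (0, 1) ^ 2 :=
      continuous_fibre_integral (H := fun x y => fderiv ℝ φ (x, y + G x) (0, 1) ^ 2) (by fun_prop) _ _
    have e : ∫ x in (0 : ℝ)..L, excess (fun x y => φ (x, y + G x))
        (fun x y => fderiv ℝ φ (x, y + G x) (1, 0) + G' x * fderiv ℝ φ (x, y + G x) (0, 1))
        (fun x y => fderiv ℝ φ (x, y + G x) (0, 1)) G' x =
        (∫ x in (0 : ℝ)..L, ∫ y in (0 : ℝ)..Real.pi, fderiv ℝ φ (x, y + G x) (1, 0) ^ 2) +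
        ((∫ x in (0 : ℝ)..L, ∫ y in (0 : ℝ)..Real.pi, fderiv ℝ φ (x, y + G x) (0, 1) ^ 2) -
        ∫ x in (0 : ℝ)..L, ∫ y in (0 : ℝ)..Real.pi, φ (x, y + G x) ^ 2) := by
      rw [← intervalIntegral.integral_sub (c2.intervalIntegrable _ _) (c0.intervalIntegrable _ _),
        ← intervalIntegral.integral_add (c1.intervalIntegrable _ _)
          (Continuous.intervalIntegrable (by fun_prop) _ _)]
      refine intervalIntegral.integral_congr fun x _ => ?_
      simp only [excess, add_sub_cancel_right]
      rw [intervalIntegral.integral_add (Continuous.intervalIntegrable (by fun_prop) _ _)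
          (Continuous.intervalIntegrable (by fun_prop) _ _), intervalIntegral.integral_sub
          (Continuous.intervalIntegrable (by fun_prop) _ _)
          (Continuous.intervalIntegrable (by fun_prop) _ _)]
    rw [e] at key
    have := mul_le_mul_of_nonneg_left key (inv_nonneg.2 hM.le)
    rw [inv_mul_cancel_left₀ hM.ne'] at this
    linarith
  · intro ε hε
    obtain ⟨C, hC⟩ := (isCompact_Icc (a := (0 : ℝ)) (b := L)).exists_bound_of_continuousOn
      hG'.continuousOn
    obtain ⟨n, hn⟩ := exists_nat_gt (max 1 ((L ^ 2 * (2 + 2 * C ^ 2) + Real.pi ^ 2) / ε))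
    have hn1 : (1 : ℝ) < n := (le_max_left _ _).trans_lt hn
    have hn0 : 0 < n := by
      have : (0 : ℝ) < n := by linarith
      exact_mod_cast this
    have hnε : L ^ 2 * (2 + 2 * C ^ 2) + Real.pi ^ 2 ≤ ε * n ^ 2 := by
      have h1 := ((le_max_right _ _).trans_lt hn)
      rw [div_lt_iff₀ hε] at h1
      nlinarith [mul_nonneg (mul_pos hε (zero_lt_one.trans hn1)).le (sub_nonneg.2 hn1.le)]
    have hn' : (0 : ℝ) < n := by linarith
    -- The grid cells, transported to the waveguide by the shear.
    set R : Fin n × Fin n → Set (ℝ × ℝ) := fun q => shear G hGc ''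
      (Set.Ioo ((q.2 : ℕ) * (L / n)) (((q.2 : ℕ) + 1 : ℕ) * (L / n)) ×ˢ
        Set.Ioo ((q.1 : ℕ) * (Real.pi / n)) (((q.1 : ℕ) + 1 : ℕ) * (Real.pi / n))) with hR
    have hgrid : ∀ (i : ℕ) (W : ℝ), 0 < W → i < n →
        Set.Ioo (i * (W / n)) ((i + 1 : ℕ) * (W / n)) ⊆ Set.Ioo 0 W := by
      intro i W hW hi
      refine Set.Ioo_subset_Ioo (by positivity) ?_
      have : ((i + 1 : ℕ) : ℝ) ≤ n := by exact_mod_cast hi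
      calc ((i + 1 : ℕ) : ℝ) * (W / n) ≤ n * (W / n) := by gcongr
        _ = W := by field_simp
    have hRsub : ∀ q, R q ⊆ graphStrip L G := fun q => by
      rw [graphStrip_eq_image L hGc]
      exact Set.image_mono (Set.prod_mono (hgrid _ _ hL q.2.2) (hgrid _ _ hpi q.1.2))
    have hRm : ∀ q, MeasurableSet (R q) := fun q =>
      ((shear G hGc).isOpenMap _ (isOpen_Ioo.prod isOpen_Ioo)).measurableSet
    have hRfin : ∀ q, volume.restrict (graphStrip L G) (R q) ≠ ⊤ := fun q => by
      refine ((Measure.restrict_le_self _).trans_lt ?_).ne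
      refine (measure_mono (Set.image_mono (Set.prod_mono Set.Ioo_subset_Icc_self
        Set.Ioo_subset_Icc_self))).trans_lt
        ((isCompact_Icc.prod isCompact_Icc).image (shear G hGc).continuous).measure_lt_top
    set c : ℝ := √((Real.pi / n)⁻¹ * (L / n)⁻¹) with hc
    refine ⟨Fin n × Fin n, inferInstance,
      fun q => c • indicatorConstLp 2 (hRm q) (hRfin q) (1 : ℝ), ?_⟩
    rintro p ⟨φ, hφ, hdisj, h0, h1, h2⟩
    have hφc := hφ.continuous
    have hfd : Continuous (fderiv ℝ φ) := hφ.continuous_fderiv (by simp)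
    have S := isStripFunction_comp_shear hG hG' (hφ.of_le (by exact_mod_cast le_top)) hL hdisj
    have hinner : ∀ q : Fin n × Fin n,
        inner ℝ (c • indicatorConstLp 2 (hRm q) (hRfin q) (1 : ℝ)) p.1 ^ 2 =
        (Real.pi / n)⁻¹ * (L / n)⁻¹ *
        (∫ x in ((q.2 : ℕ) * (L / n))..(((q.2 : ℕ) + 1 : ℕ) * (L / n)),
          ∫ y in ((q.1 : ℕ) * (Real.pi / n))..(((q.1 : ℕ) + 1 : ℕ) * (Real.pi / n)),
            φ (x, y + G x)) ^ 2 := by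
      intro q
      rw [real_inner_smul_left, mul_pow, hc, Real.sq_sqrt (by positivity),
        L2.inner_indicatorConstLp_one, Measure.restrict_restrict (hRm q),
        Set.inter_eq_left.2 (hRsub q)]
      have : ∫ x in R q, p.1 x = ∫ x in R q, φ x :=
        integral_congr_ae (ae_restrict_of_ae_restrict_of_subset (hRsub q) h0)
      rw [this, hR, setIntegral_image_shear hGc hφc (by gcongr; simp) (by gcongr; simp)]
    have key := grid_estimate S.cont S.cont_x S.cont_y S.deriv_x S.deriv_y hL hpi hn0
    rw [norm_sq_eq_integral _ h0, norm_sq_eq_integral _ h1, norm_sq_eq_integral _ h2,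
      hint _ (by fun_prop), hint _ (by fun_prop), hint _ (by fun_prop)]
    simp_rw [hinner]
    rw [Fintype.sum_prod_type]
    simp_rw [Finset.sum_range] at key
    set w1 := ∫ x in (0 : ℝ)..L, ∫ y in (0 : ℝ)..Real.pi, fderiv ℝ φ (x, y + G x) (1, 0) ^ 2 with hw1
    set w2 := ∫ x in (0 : ℝ)..L, ∫ y in (0 : ℝ)..Real.pi, fderiv ℝ φ (x, y + G x) (0, 1) ^ 2 with hw2
    have hw1' : 0 ≤ w1 := intervalIntegral.integral_nonneg hL.le fun x _ =>
      intervalIntegral.integral_nonneg hpi.le fun y _ => sq_nonneg _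
    have hw2' : 0 ≤ w2 := intervalIntegral.integral_nonneg hL.le fun x _ =>
      intervalIntegral.integral_nonneg hpi.le fun y _ => sq_nonneg _
    have hX : ∫ x in (0 : ℝ)..L, ∫ y in (0 : ℝ)..Real.pi, (fderiv ℝ φ (x, y + G x) (1, 0) +
        G' x * fderiv ℝ φ (x, y + G x) (0, 1)) ^ 2 ≤ 2 * w1 + 2 * C ^ 2 * w2 := by
      have c0 : Continuous fun x => ∫ y in (0 : ℝ)..Real.pi, (fderiv ℝ φ (x, y + G x) (1, 0) +
          G' x * fderiv ℝ φ (x, y + G x) (0, 1)) ^ 2 :=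
        continuous_fibre_integral (H := fun x y => (fderiv ℝ φ (x, y + G x) (1, 0) +
          G' x * fderiv ℝ φ (x, y + G x) (0, 1)) ^ 2) (by fun_prop) _ _
      have c1 : Continuous fun x => ∫ y in (0 : ℝ)..Real.pi, fderiv ℝ φ (x, y + G x) (1, 0) ^ 2 :=
        continuous_fibre_integral (H := fun x y => fderiv ℝ φ (x, y + G x) (1, 0) ^ 2) (by fun_prop) _ _
      have c2 : Continuous fun x => ∫ y in (0 : ℝ)..Real.pi, fderiv ℝ φ (x, y + G x) (0, 1) ^ 2 :=
        continuous_fibre_integral (H := fun x y => fderiv ℝ φ (x, y + G x) (0, 1) ^ 2) (by fun_prop) _ _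
      rw [hw1, hw2, ← intervalIntegral.integral_const_mul, ← intervalIntegral.integral_const_mul,
        ← intervalIntegral.integral_add (Continuous.intervalIntegrable (by fun_prop) _ _)
          (Continuous.intervalIntegrable (by fun_prop) _ _)]
      refine intervalIntegral.integral_mono_on hL.le (c0.intervalIntegrable _ _)
        (Continuous.intervalIntegrable (by fun_prop) _ _) fun x hx => ?_
      rw [← intervalIntegral.integral_const_mul, ← intervalIntegral.integral_const_mul,
        ← intervalIntegral.integral_add (Continuous.intervalIntegrable (by fun_prop) _ _)
          (Continuous.intervalIntegrable (by fun_prop) _ _)]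
      refine intervalIntegral.integral_mono_on hpi.le (Continuous.intervalIntegrable (by fun_prop) _ _)
        (Continuous.intervalIntegrable (by fun_prop) _ _) fun y _ => ?_
      have hCx : G' x ^ 2 ≤ C ^ 2 := by
        rw [← sq_abs]
        exact pow_le_pow_left₀ (abs_nonneg _) (hC x hx) 2
      set A := fderiv ℝ φ (x, y + G x) (1, 0)
      set B := fderiv ℝ φ (x, y + G x) (0, 1)
      nlinarith [sq_nonneg (A - G' x * B), mul_le_mul_of_nonneg_right hCx (sq_nonneg B)]
    have hfin : (L / n) ^ 2 * (2 * w1 + 2 * C ^ 2 * w2) + (Real.pi / n) ^ 2 * w2 ≤ ε * (w1 + w2) := by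
      have e : (L / n) ^ 2 * (2 * w1 + 2 * C ^ 2 * w2) + (Real.pi / n) ^ 2 * w2 =
          (L ^ 2 * (2 * w1 + 2 * C ^ 2 * w2) + Real.pi ^ 2 * w2) / n ^ 2 := by field_simp
      rw [e, div_le_iff₀ (by positivity)]
      have h3 : L ^ 2 * (2 * w1 + 2 * C ^ 2 * w2) + Real.pi ^ 2 * w2 ≤
          (L ^ 2 * (2 + 2 * C ^ 2) + Real.pi ^ 2) * (w1 + w2) := by
        have a1 : 0 ≤ L ^ 2 * C ^ 2 * w1 := by positivity
        have a2 : 0 ≤ L ^ 2 * w2 := by positivity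
        have a3 : 0 ≤ Real.pi ^ 2 * w1 := by positivity
        nlinarith
      calc _ ≤ _ := h3
        _ ≤ (ε * n ^ 2) * (w1 + w2) := by gcongr
        _ = _ := by ring
    have h4 := mul_le_mul_of_nonneg_left hX (sq_nonneg (L / n))
    linarith

/-! ### Random sites -/

theorem IsSiteLaw.mean_pos {μ : Measure ℝ≥0} [IsProbabilityMeasure μ] (hμ : IsSiteLaw μ) :
    0 < mean μ := by
  have hint : Integrable (fun x : ℝ≥0 => (x : ℝ)) μ := by
    refine Integrable.of_mem_Icc 0 1 (by fun_prop) ?_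
    filter_upwards [hμ.bounded] with x hx
    exact ⟨x.2, by exact_mod_cast hx⟩
  have hnn : 0 ≤ mean μ := integral_nonneg fun x => x.2
  refine hnn.lt_of_ne fun h => hμ.nontrivial ?_
  have hae : (fun x : ℝ≥0 => (x : ℝ)) =ᵐ[μ] 0 :=
    (integral_eq_zero_iff_of_nonneg (fun x => x.2) hint).1 h.symm
  have h0 : ∀ᵐ x ∂μ, x = 0 := by
    filter_upwards [hae] with x hx
    exact NNReal.coe_eq_zero.1 hx
  ext s hs
  by_cases hs0 : (0 : ℝ≥0) ∈ s
  · rw [Measure.dirac_apply_of_mem hs0, prob_compl_eq_zero_iff hs |>.1]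
    refine measure_mono_null (fun x hx => ?_) h0
    rintro (rfl : x = 0)
    exact hx hs0
  · rw [Measure.dirac_apply' _ hs, Set.indicator_of_notMem hs0]
    refine measure_mono_null (fun x hx => ?_) h0
    rintro (rfl : x = 0)
    exact hs0 hx

theorem ae_site_le_one {μ : Measure ℝ≥0} [IsProbabilityMeasure μ] (hμ : IsSiteLaw μ) :
    ∀ᵐ ω ∂Measure.infinitePi (fun _ : ℤ => μ), ∀ k, ω k ≤ 1 := by
  rw [ae_all_iff]
  intro k
  exact (measurePreserving_eval_infinitePi (fun _ : ℤ => μ) k).quasiMeasurePreserving.ae hμ.bounded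

/-- Hoeffding's inequality for the lower tail of the sum over a block of sites. -/
theorem measure_block_sum_lt_le {μ : Measure ℝ≥0} [IsProbabilityMeasure μ] (hμ : IsSiteLaw μ)
    (n K : ℕ) :
    Measure.infinitePi (fun _ : ℤ => μ)
      {ω : Config | ∑ k ∈ Finset.Ico n (n + K), (ω (k : ℤ) : ℝ) < K * mean μ / 2} ≤
    ENNReal.ofReal (Real.exp (-(mean μ ^ 2 / 2) * K)) := by
  have hmeas : ∀ k : ℤ, Measurable fun ω : Config => (ω k : ℝ) := fun k => by fun_prop
  have hEval : ∀ k : ℤ, ∫ ω, -(ω k : ℝ) ∂Measure.infinitePi (fun _ : ℤ => μ) = -mean μ := by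
    intro k
    have hmp := measurePreserving_eval_infinitePi (fun _ : ℤ => μ) k
    have h := integral_map (μ := Measure.infinitePi fun _ : ℤ => μ) (f := fun x : ℝ≥0 => (x : ℝ)) hmp.measurable.aemeasurable
      (by fun_prop)
    rw [hmp.map_eq] at h
    rw [integral_neg, mean, h]
  have hind : ProbabilityTheory.iIndepFun (fun (k : ℕ) (ω : Config) => -(ω (k : ℤ) : ℝ) - -mean μ)
      (Measure.infinitePi (fun _ : ℤ => μ)) :=
    (ProbabilityTheory.iIndepFun_infinitePi (P := fun _ : ℤ => μ)
      (X := fun (_ : ℤ) (x : ℝ≥0) => -(x : ℝ) - -mean μ) (fun _ => by fun_prop)).precomp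
      Nat.cast_injective
  have hsub : ∀ k ∈ Finset.Ico n (n + K), ProbabilityTheory.HasSubgaussianMGF
      (fun ω : Config => -(ω (k : ℤ) : ℝ) - -mean μ) ((fun _ : ℕ => (1 / 4 : ℝ≥0)) k)
      (Measure.infinitePi (fun _ : ℤ => μ)) := by
    intro k _
    have h := ProbabilityTheory.hasSubgaussianMGF_of_mem_Icc
      (μ := Measure.infinitePi (fun _ : ℤ => μ)) (X := fun ω : Config => -(ω (k : ℤ) : ℝ))
      (a := -1) (b := 0) (hmeas k).neg.aemeasurable (by
        filter_upwards [ae_site_le_one hμ] with ω hω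
        have : (ω (k : ℤ) : ℝ) ≤ 1 := by exact_mod_cast hω k
        exact ⟨by linarith, by simp⟩)
    rw [hEval] at h
    convert h using 1
    ext; norm_num
  have h := ProbabilityTheory.HasSubgaussianMGF.measure_sum_ge_le_of_iIndepFun hind hsub
    (ε := K * mean μ / 2) (by have := hμ.mean_pos; positivity)
  rw [measureReal_def] at h
  have h2 := (ENNReal.le_ofReal_iff_toReal_le (measure_ne_top _ _) (Real.exp_pos _).le).2 h
  refine (measure_mono fun ω hω => ?_).trans (h2.trans (ENNReal.ofReal_le_ofReal ?_))
  · simp only [Set.mem_ofPred_eq, Finset.sum_sub_distrib, Finset.sum_neg_distrib, Finset.sum_const,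
      Nat.card_Ico, add_tsub_cancel_left, nsmul_eq_mul] at hω ⊢
    linarith
  · refine Real.exp_le_exp.2 (le_of_eq ?_)
    simp only [Finset.sum_const, Nat.card_Ico, add_tsub_cancel_left, nsmul_eq_mul]
    push_cast
    rcases Nat.eq_zero_or_pos K with rfl | hK
    · simp
    · field_simp
      ring

/-! ### Bump functions and the deterministic bound -/

theorem abs_le_supNorm {l : ℝ} {f : ℝ → ℝ} (hf : Continuous f) {x : ℝ} (hx : x ∈ Set.Icc 0 l) :
    |f x| ≤ supNorm l f :=
  le_csSup (isCompact_Icc.image hf.abs).bddAbove ⟨x, hx, rfl⟩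

namespace IsBump

variable {l : ℝ} {g : ℝ → ℝ}

theorem hasDerivAt (hg : IsBump l g) (x : ℝ) : HasDerivAt g (deriv g x) x :=
  (hg.contDiff.differentiable (by norm_num) x).hasDerivAt

theorem contDiff_deriv (hg : IsBump l g) : ContDiff ℝ 1 (deriv g) :=
  ContDiff.iterate_deriv' 1 1 hg.contDiff

theorem hasDerivAt_deriv (hg : IsBump l g) (x : ℝ) :
    HasDerivAt (deriv g) (deriv (deriv g) x) x :=
  (hg.contDiff_deriv.differentiable (by norm_num) x).hasDerivAt

theorem continuous_deriv_deriv (hg : IsBump l g) : Continuous (deriv (deriv g)) :=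
  hg.contDiff_deriv.continuous_deriv (by norm_num)

theorem eq_zero (hg : IsBump l g) {x : ℝ} (hx : x ∉ Set.Ioo 0 l) : g x = 0 :=
  image_eq_zero_of_notMem_tsupport fun h => hx (hg.tsupport_subset h)

theorem deriv_eq_zero (hg : IsBump l g) {x : ℝ} (hx : x ∉ Set.Ioo 0 l) : deriv g x = 0 := by
  by_contra h
  exact hx (hg.tsupport_subset (support_deriv_subset h))

theorem abs_deriv_le (hg : IsBump l g) {x : ℝ} (hx : x ∈ Set.Icc 0 l) : |deriv g x| ≤ 1 := by
  refine (abs_le_supNorm hg.contDiff_deriv.continuous hx).trans ?_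
  rw [← hg.normalized]
  exact (le_max_left _ _).trans (le_max_right _ _)

theorem abs_deriv_deriv_le (hg : IsBump l g) {x : ℝ} (hx : x ∈ Set.Icc 0 l) :
    |deriv (deriv g) x| ≤ 1 := by
  refine (abs_le_supNorm hg.continuous_deriv_deriv hx).trans ?_
  rw [← hg.normalized]
  exact (le_max_right _ _).trans (le_max_right _ _)

theorem ne_zero (hg : IsBump l g) : g ≠ 0 := by
  rintro rfl
  have h0 : ∀ f : ℝ → ℝ, (∀ x, f x = 0) → supNorm l f ≤ 0 := by
    intro f hf
    refine Real.sSup_nonpos ?_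
    rintro _ ⟨x, -, rfl⟩
    simp [hf x]
  have hd : ∀ x, deriv (0 : ℝ → ℝ) x = 0 := fun x => by simp [Pi.zero_def]
  have hd' : deriv (0 : ℝ → ℝ) = 0 := funext hd
  have h := hg.normalized
  rw [hd'] at h
  rw [hd'] at h
  have := h0 0 fun _ => rfl
  rw [max_self, max_self] at h
  linarith

/-- The slope of a bump function does not vanish identically. -/
theorem integral_deriv_sq_pos (hg : IsBump l g) (hl : 0 < l) :
    0 < ∫ x in (0 : ℝ)..l, deriv g x ^ 2 := by
  have hc := hg.contDiff_deriv.continuous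
  by_contra hcon
  refine hg.ne_zero ?_
  have hz : ∀ x, deriv g x = 0 := by
    intro x
    by_cases hx : x ∈ Set.Ioo 0 l
    · by_contra hne
      refine hcon (intervalIntegral.integral_pos hl (by fun_prop) (fun _ _ => sq_nonneg _)
        ⟨x, Set.Ioo_subset_Icc_self hx, by positivity⟩)
    · exact hg.deriv_eq_zero hx
  funext x
  rw [is_const_of_deriv_eq_zero (hg.contDiff.differentiable (by norm_num)) hz x 0,
    hg.eq_zero (by simp)]
  rfl

theorem centeredNorm_pos (hg : IsBump l g) (hl : 0 < l) : 0 < centeredNorm l g := by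
  have hc : Continuous (centered l g) := by
    have := hg.contDiff.continuous
    unfold centered
    fun_prop
  refine Real.sqrt_pos.2 ?_
  by_contra hcon
  refine hg.ne_zero ?_
  have hz : ∀ x ∈ Set.Icc 0 l, centered l g x = 0 := by
    intro x hx
    by_contra hne
    exact hcon (intervalIntegral.integral_pos hl (by fun_prop) (fun _ _ => sq_nonneg _)
      ⟨x, hx, by positivity⟩)
  funext x
  by_cases hx : x ∈ Set.Ioo 0 l
  · have h1 := hz x (Set.Ioo_subset_Icc_self hx)
    have h2 := hz 0 ⟨le_rfl, hl.le⟩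
    have h3 : g 0 = 0 := hg.eq_zero (by simp)
    simp only [centered] at h1 h2
    simp only [Pi.zero_apply]
    linarith
  · exact hg.eq_zero hx

theorem c₂_pos (hg : IsBump l g) (hl : 0 < l) : 0 < c₂ l g := by
  have := hg.centeredNorm_pos hl
  unfold c₂
  positivity

theorem c₃_pos (hg : IsBump l g) (hl : 0 < l) : 0 < c₃ l g := by
  have := hg.centeredNorm_pos hl
  unfold c₃
  positivity

/-- Over the segment with `N` cells, only the first `N` bumps are visible. -/
theorem shape_eq_sum (hg : IsBump l g) (hl : 0 < l) (ω : Config) {N : ℕ} {x : ℝ}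
    (hx : x ∈ Set.Ioo 0 (N * l)) :
    shape l g ω x = ∑ k ∈ Finset.range N, (ω (k : ℤ) : ℝ) * g (x - k * l) := by
  unfold shape
  rw [tsum_eq_sum (s := (Finset.range N).map Nat.castEmbedding)]
  · simp
  · intro k hk
    rw [hg.eq_zero, mul_zero]
    rintro ⟨h1, h2⟩
    refine hk (Finset.mem_map.2 ?_)
    have hk0 : 0 ≤ k := by
      by_contra! hneg
      have : (k : ℝ) ≤ -1 := by exact_mod_cast Int.le_sub_one_of_lt hneg
      nlinarith [hx.1]
    have hkN : k < N := by
      by_contra! hge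
      have : (N : ℝ) ≤ k := by exact_mod_cast hge
      nlinarith [hx.2]
    lift k to ℕ using hk0
    exact ⟨k, Finset.mem_range.2 (by exact_mod_cast hkN), rfl⟩

/-- Over the `k`-th cell, only the `k`-th bump contributes to the slope. -/
theorem sum_deriv_eq (hg : IsBump l g) (w : ℕ → ℝ) {N k : ℕ} (hk : k < N) {x : ℝ}
    (hx : x ∈ Set.Icc (k * l) ((k + 1) * l)) (hl : 0 < l) :
    ∑ j ∈ Finset.range N, w j * deriv g (x - j * l) = w k * deriv g (x - k * l) := by
  refine Finset.sum_eq_single k (fun j _ hj => ?_) (fun h => absurd (Finset.mem_range.2 hk) h)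
  rw [hg.deriv_eq_zero, mul_zero]
  rintro ⟨h1, h2⟩
  rcases lt_or_gt_of_ne hj with h | h
  · have : (j : ℝ) + 1 ≤ k := by exact_mod_cast h
    nlinarith [hx.1]
  · have : (k : ℝ) + 1 ≤ j := by exact_mod_cast h
    nlinarith [hx.2]

end IsBump

/-- A deterministic lower bound for the lowest eigenvalue: it suffices that every block of `K`
consecutive sites carries at least half of the expected mass. -/
theorem le_lowestEigenvalue {l : ℝ} {g : ℝ → ℝ} (hl : 0 < l) (hg : IsBump l g) {κ : ℝ} (hκ : 0 < κ)
    (hκ1 : κ ≤ 1) {ω : Config} (hω : ∀ k, ω k ≤ 1) {N K : ℕ} (hK : 0 < K) (hKN : K ≤ N) {m : ℝ}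
    (hm : 0 < m)
    (hgood : ∀ j < N / K, K * m / 2 ≤ ∑ k ∈ Finset.Ico (j * K) (j * K + K), (ω (k : ℤ) : ℝ)) :
    1 + (100 * (2 * K * l) ^ 2 *
      ((κ * (K * m / 2) * ∫ x in (0 : ℝ)..l, deriv g x ^ 2)⁻¹ + 1) ^ 2 + 4)⁻¹ ≤
      lowestEigenvalue l g κ ω N 0 := by
  have hN : 0 < N := hK.trans_le hKN
  have hNr : (0 : ℝ) < N := by exact_mod_cast hN
  have hKr : (0 : ℝ) < K := by exact_mod_cast hK
  have hL : 0 < N * l := by positivity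
  set Γ := ∫ x in (0 : ℝ)..l, deriv g x ^ 2 with hΓ
  have hΓ0 : 0 < Γ := hg.integral_deriv_sq_pos hl
  have hd1 : Continuous (deriv g) := hg.contDiff_deriv.continuous
  set t : ℕ → ℝ := fun k => κ * (ω (k : ℤ) : ℝ) with ht
  have ht0 : ∀ k, 0 ≤ t k := fun k => by positivity
  have ht1 : ∀ k, t k ≤ 1 := fun k =>
    mul_le_one₀ hκ1 (by positivity) (by exact_mod_cast hω k)
  set G : ℝ → ℝ := fun x => ∑ k ∈ Finset.range N, t k * g (x - k * l) with hG
  set τ : ℝ → ℝ := fun x => ∑ k ∈ Finset.range N, t k * deriv g (x - k * l) with hτ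
  have hGd : ∀ x, HasDerivAt G (τ x) x := fun x =>
    HasDerivAt.fun_sum fun k _ => ((hg.hasDerivAt (x - k * l)).comp_sub_const x (k * l)).const_mul (t k)
  have hτc : Continuous τ := by fun_prop
  have hshape : ∀ x, 0 < x → x < N * l → κ * shape l g ω x = G x := fun x h0 h1 => by
    rw [hg.shape_eq_sum hl ω ⟨h0, h1⟩, Finset.mul_sum]
    exact Finset.sum_congr rfl fun k _ => by rw [ht]; ring
  have hseg : segment l g κ ω N 0 = graphStrip (N * l) G := by
    ext x
    simp only [segment, graphStrip, Int.cast_zero, zero_mul, zero_add, Set.mem_ofPred_eq]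
    refine and_congr_right fun h0 => and_congr_right fun h1 => ?_
    rw [hshape _ h0 h1]
  have hwall : wall l g κ ω N 0 = graphWall (N * l) G := by
    ext x
    simp only [wall, graphWall, Int.cast_zero, zero_mul, zero_add, Set.mem_union, Set.mem_ofPred_eq]
    refine or_congr ?_ ?_ <;>
    · refine and_congr_right fun h0 => and_congr_right fun h1 => ?_
      rw [hshape _ h0 h1]
  have hcell : ∀ k < N, ∀ x ∈ Set.Icc (k * l) ((k + 1) * l), τ x = t k * deriv g (x - k * l) :=
    fun k hk x hx => hg.sum_deriv_eq t hk hx hl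
  have hτ1 : ∀ x ∈ Set.Icc 0 (N * l), |τ x| ≤ 1 := by
    intro x hx
    obtain ⟨k, hk, hxk⟩ : ∃ k < N, x ∈ Set.Icc ((k : ℕ) * l) ((k + 1) * l) := by
      rcases hx.2.eq_or_lt with rfl | hlt
      · refine ⟨N - 1, by omega, ?_⟩
        rw [Nat.cast_sub hN, Nat.cast_one, sub_add_cancel]
        exact ⟨by nlinarith, le_rfl⟩
      · have h1 := Nat.floor_le (div_nonneg hx.1 hl.le)
        have h2 := Nat.lt_floor_add_one (x / l)
        refine ⟨⌊x / l⌋₊, (Nat.floor_lt (div_nonneg hx.1 hl.le)).2 ((div_lt_iff₀ hl).2 hlt), ?_, ?_⟩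
        · exact (le_div_iff₀ hl).1 h1
        · exact (div_le_iff₀ hl).1 h2.le
    rw [hcell k hk x hxk, abs_mul, abs_of_nonneg (ht0 k)]
    exact mul_le_one₀ (ht1 k) (abs_nonneg _)
      (hg.abs_deriv_le ⟨by linarith [hxk.1], by linarith [hxk.2]⟩)
  rw [lowestEigenvalue, hseg, hwall]
  set W := κ * (K * m / 2) * Γ with hW
  have hW0 : 0 < W := by positivity
  set M := 100 * (2 * K * l) ^ 2 * (W⁻¹ + 1) ^ 2 + 4 with hM
  have hM0 : 0 < M := by positivity
  refine le_sInf_isEigenvalue_graphStrip hL hGd hτc hM0 fun F Fx Fy S => ?_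
  -- The last of the `N / K` blocks also absorbs the remaining `N % K` cells.
  set J := N / K with hJ
  have hJ1 : 0 < J := Nat.div_pos hKN hK
  have hJK : J * K ≤ N := Nat.div_mul_le_self N K
  have hJK' : N < J * K + K := by
    have := Nat.lt_div_mul_add hK (a := N)
    simpa [hJ] using this
  set p : ℕ → ℕ := fun j => if j < J then j * K else N with hp
  have hpN : ∀ j, p j ≤ N := by
    intro j
    simp only [hp]
    split_ifs with h
    · exact (Nat.mul_le_mul_right K h.le).trans hJK
    · exact le_rfl
  have block : ∀ j < J, ∫ x in (p j * l)..(p (j + 1) * l), ∫ y in (0 : ℝ)..Real.pi, F x y ^ 2 ≤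
      M * ∫ x in (p j * l)..(p (j + 1) * l), excess F Fx Fy τ x := by
    intro j hj
    have e1 : p j = j * K := if_pos hj
    have e2 : p j + K ≤ p (j + 1) ∧ p (j + 1) ≤ p j + 2 * K := by
      rw [e1]
      simp only [hp]
      split_ifs with h
      · constructor <;> nlinarith
      · have : j + 1 = J := by omega
        rw [← this] at hJK hJK'
        constructor <;> nlinarith
    refine block_mass_le S hτc hτ1 hl (by omega) ?_ ht0 hg.hasDerivAt_deriv
      hg.continuous_deriv_deriv (hg.deriv_eq_zero (by simp)) (hg.deriv_eq_zero (by simp))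
      (fun x hx => hg.abs_deriv_le hx) (fun x hx => hg.abs_deriv_deriv_le hx) ?_ hW0 ?_ ?_
    · gcongr
      exact hpN _
    · intro k hk x hx
      exact hcell k ((Finset.mem_Ico.1 hk).2.trans_le (hpN _)) x hx
    · rw [hW]
      gcongr
      calc κ * (K * m / 2) ≤ κ * ∑ k ∈ Finset.Ico (j * K) (j * K + K), (ω (k : ℤ) : ℝ) := by
            gcongr
            exact hgood j hj
        _ = ∑ k ∈ Finset.Ico (j * K) (j * K + K), t k := by rw [Finset.mul_sum]
        _ ≤ ∑ k ∈ Finset.Ico (p j) (p (j + 1)), t k := by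
            refine Finset.sum_le_sum_of_subset_of_nonneg ?_ fun k _ _ => ht0 k
            rw [e1] at e2 ⊢
            exact Finset.Ico_subset_Ico le_rfl e2.1
    · have h1 : (p j : ℝ) + K ≤ p (j + 1) := by exact_mod_cast e2.1
      have h2 : (p (j + 1) : ℝ) ≤ p j + 2 * K := by exact_mod_cast e2.2
      have h3 : (0 : ℝ) ≤ p (j + 1) - p j := by linarith
      rw [hM]
      gcongr
      linarith
  have cF := S.cont
  have cF2 : Continuous fun x => ∫ y in (0 : ℝ)..Real.pi, F x y ^ 2 :=
    continuous_fibre_integral (H := fun x y => F x y ^ 2) (by fun_prop) _ _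
  have hsum : ∀ h : ℝ → ℝ, Continuous h → ∫ x in (0 : ℝ)..(N * l), h x =
      ∑ j ∈ Finset.range J, ∫ x in (p j * l)..(p (j + 1) * l), h x := by
    intro h hh
    rw [intervalIntegral.sum_integral_adjacent_intervals (a := fun j : ℕ => (p j : ℝ) * l)
      fun k _ => hh.intervalIntegrable _ _]
    simp [hp, hJ1]
  rw [hsum _ cF2, hsum _ (continuous_excess S hτc), Finset.mul_sum]
  exact Finset.sum_le_sum fun j hj => block j (Finset.mem_range.1 hj)

/-! ### Asymptotics and the union bound -/

open Filter Topology in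
theorem eventually_mul_rpow_le (A : ℝ) {a c : ℝ} (ha : 0 < a) (hc : 0 < c) :
    ∀ᶠ N : ℕ in atTop, A * (N : ℝ) ^ (-a) ≤ c := by
  have h : Tendsto (fun N : ℕ => A * (N : ℝ) ^ (-a)) atTop (𝓝 0) := by
    simpa using ((tendsto_rpow_neg_atTop ha).comp tendsto_natCast_atTop_atTop).const_mul A
  exact h.eventually (ge_mem_nhds hc)

theorem eventually_couplingInterval_nonempty {l : ℝ} {g : ℝ → ℝ} (hl : 0 < l) (hg : IsBump l g)
    {γ : ℝ} (hγ : 34 < γ) (μ : Measure ℝ≥0) :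
    ∀ᶠ N : ℕ in Filter.atTop, (couplingInterval μ l g γ N).Nonempty := by
  have ha : 0 < 1 / 4 - 17 / (2 * γ) := by
    rw [sub_pos, div_lt_div_iff₀ (by linarith) (by norm_num)]
    linarith
  filter_upwards [eventually_mul_rpow_le (2 / (mean μ * √(c₂ l g))) ha (hg.c₃_pos hl),
    Filter.eventually_gt_atTop 0] with N hN hN0
  have hNr : (0 : ℝ) < N := by exact_mod_cast hN0
  refine Set.nonempty_Icc.2 ?_
  have e : (N : ℝ) ^ (1 / γ - 1 / 4) =
      (N : ℝ) ^ (-(1 / 4 - 17 / (2 * γ))) * (N : ℝ) ^ (-(15 / (2 * γ))) := by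
    rw [← Real.rpow_add hNr]
    congr 1
    field_simp
    ring
  calc 2 * (N : ℝ) ^ (1 / γ - 1 / 4) / (mean μ * √(c₂ l g))
      = 2 / (mean μ * √(c₂ l g)) * (N : ℝ) ^ (-(1 / 4 - 17 / (2 * γ))) *
          (N : ℝ) ^ (-(15 / (2 * γ))) := by rw [e]; ring
    _ ≤ _ := by gcongr

/-- On the lower end of the coupling interval, blocks of length about `N ^ (1 / γ)` produce a gap
larger than `N ^ (-1 / 2)`. -/
theorem eventually_gap {l B m s γ : ℝ} (hl : 0 < l) (hB : 0 < B) (hm : 0 < m) (hs : 0 < s)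
    (hγ : 4 < γ) :
    ∀ᶠ N : ℕ in Filter.atTop, ∀ κ : ℝ, 2 * (N : ℝ) ^ (1 / γ - 1 / 4) / (m * s) ≤ κ →
      (N : ℝ) ^ (-(1 / 2) : ℝ) <
        (100 * (2 * (⌈(N : ℝ) ^ (1 / γ)⌉₊ : ℝ) * l) ^ 2 *
          ((κ * (⌈(N : ℝ) ^ (1 / γ)⌉₊ * m / 2) * B)⁻¹ + 1) ^ 2 + 4)⁻¹ := by
  have hγ0 : 0 < γ := by linarith
  have hg1 : 0 < 1 / γ := by positivity
  have hg2 : 0 < 1 / 4 - 1 / γ := by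
    rw [sub_pos]
    exact one_div_lt_one_div_of_lt (by norm_num) hγ
  -- The two contributions to `√M / N ^ (1 / 4)` are each made at most `1 / (80 l)`.
  filter_upwards [eventually_mul_rpow_le (s / B) hg1 (show 0 < 1 / (80 * l) by positivity),
    eventually_mul_rpow_le 2 hg2 (show 0 < 1 / (80 * l) by positivity),
    eventually_mul_rpow_le 4 (show (0 : ℝ) < 1 / 2 by norm_num) (show (0 : ℝ) < 1 / 2 by norm_num),
    Filter.eventually_gt_atTop 0] with N h1 h2 h3 hN0 κ hκ
  have hNr : (1 : ℝ) ≤ N := by exact_mod_cast hN0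
  have hNp : (0 : ℝ) < N := by linarith
  set K : ℝ := (⌈(N : ℝ) ^ (1 / γ)⌉₊ : ℝ) with hK
  have hy1 : 1 ≤ (N : ℝ) ^ (1 / γ) := Real.one_le_rpow hNr hg1.le
  have hK1 : (N : ℝ) ^ (1 / γ) ≤ K := Nat.le_ceil _
  have hK2 : K ≤ 2 * (N : ℝ) ^ (1 / γ) := by
    have := Nat.ceil_lt_add_one (zero_le_one.trans hy1)
    linarith
  have hKp : 0 < K := by linarith
  set q : ℝ := (N : ℝ) ^ (1 / 4 : ℝ) with hq
  have hqp : 0 < q := Real.rpow_pos_of_pos hNp _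
  have hq2 : (N : ℝ) ^ (1 / 2 : ℝ) = q ^ 2 := by
    rw [hq, ← Real.rpow_natCast, ← Real.rpow_mul hNp.le]; norm_num
  have e1 : (N : ℝ) ^ (1 / γ) = q * (N : ℝ) ^ (-(1 / 4 - 1 / γ)) := by
    rw [hq, ← Real.rpow_add hNp]; congr 1; ring
  have e2 : (N : ℝ) ^ (1 / γ - 1 / 4) = (q * (N : ℝ) ^ (-(1 / γ)))⁻¹ := by
    rw [hq, ← Real.rpow_add hNp, ← Real.rpow_neg hNp.le]; congr 1; ring
  set z := (N : ℝ) ^ (-(1 / γ)) with hz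
  have hzp : 0 < z := Real.rpow_pos_of_pos hNp _
  have hlow : 0 < 2 * (N : ℝ) ^ (1 / γ - 1 / 4) / (m * s) := by positivity
  have hW : K * ((κ * (K * m / 2) * B)⁻¹ + 1) ≤ q * (1 / (40 * l)) := by
    have h4 : (κ * (K * m / 2) * B)⁻¹ ≤
        (2 * (N : ℝ) ^ (1 / γ - 1 / 4) / (m * s) * (K * m / 2) * B)⁻¹ := by
      gcongr
    have h5 : K * (2 * (N : ℝ) ^ (1 / γ - 1 / 4) / (m * s) * (K * m / 2) * B)⁻¹ = q * (s / B * z) := by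
      rw [e2]; field_simp
    calc K * ((κ * (K * m / 2) * B)⁻¹ + 1)
        ≤ K * ((2 * (N : ℝ) ^ (1 / γ - 1 / 4) / (m * s) * (K * m / 2) * B)⁻¹ + 1) := by gcongr
      _ = q * (s / B * z) + K := by rw [mul_add, h5, mul_one]
      _ ≤ q * (s / B * z) + q * (2 * (N : ℝ) ^ (-(1 / 4 - 1 / γ))) := by rw [e1] at hK2; linarith
      _ ≤ q * (1 / (80 * l)) + q * (1 / (80 * l)) := by gcongr
      _ = q * (1 / (40 * l)) := by field_simp; norm_num
  have hκ0 : 0 < κ := hlow.trans_le hκ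
  rw [Real.rpow_neg hNp.le]
  refine inv_strictAnti₀ (by positivity) ?_
  have h6 : 100 * (2 * K * l) ^ 2 * ((κ * (K * m / 2) * B)⁻¹ + 1) ^ 2 ≤ q ^ 2 / 4 := by
    calc _ = 400 * l ^ 2 * (K * ((κ * (K * m / 2) * B)⁻¹ + 1)) ^ 2 := by ring
      _ ≤ 400 * l ^ 2 * (q * (1 / (40 * l))) ^ 2 := by gcongr
      _ = q ^ 2 / 4 := by field_simp; norm_num
  have h7 : 4 ≤ q ^ 2 / 2 := by
    rw [Real.rpow_neg hNp.le, hq2] at h3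
    have : 4 = 4 * (q ^ 2)⁻¹ * q ^ 2 := by field_simp
    rw [this]
    calc _ ≤ 1 / 2 * q ^ 2 := by gcongr
      _ = _ := by ring
  rw [hq2]
  have : 0 < q ^ 2 := by positivity
  linarith

/-- The event that some block of `K` sites is too light, or that some site exceeds `1`, is rare. -/
theorem measure_bad_le {μ : Measure ℝ≥0} [IsProbabilityMeasure μ] (hμ : IsSiteLaw μ) (J K : ℕ)
    {s : Set Config}
    (hs : ∀ ω : Config, (∀ k, ω k ≤ 1) → (∀ j < J, K * mean μ / 2 ≤
      ∑ k ∈ Finset.Ico (j * K) (j * K + K), (ω (k : ℤ) : ℝ)) → ω ∉ s) :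
    Measure.infinitePi (fun _ : ℤ => μ) s ≤
      ENNReal.ofReal (J * Real.exp (-(mean μ ^ 2 / 2) * K)) := by
  have hsub : s ⊆ {ω : Config | ¬ ∀ k, ω k ≤ 1} ∪ ⋃ j ∈ Finset.range J,
      {ω : Config | ∑ k ∈ Finset.Ico (j * K) (j * K + K), (ω (k : ℤ) : ℝ) < K * mean μ / 2} := by
    intro ω hω
    by_contra hcon
    simp only [Set.mem_union, Set.mem_ofPred_eq, Set.mem_iUnion, Finset.mem_range, not_or, not_not,
      not_exists, not_lt] at hcon
    exact hs ω hcon.1 hcon.2 hω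
  refine (measure_mono hsub).trans ((measure_union_le _ _).trans ?_)
  rw [show Measure.infinitePi (fun _ : ℤ => μ) {ω : Config | ¬ ∀ k, ω k ≤ 1} = 0 from
    ae_site_le_one hμ, zero_add]
  refine (measure_biUnion_finset_le _ _).trans
    ((Finset.sum_le_sum fun j _ => measure_block_sum_lt_le hμ (j * K) K).trans ?_)
  rw [Finset.sum_const, Finset.card_range, nsmul_eq_mul, ENNReal.ofReal_mul (by positivity),
    ENNReal.ofReal_natCast]

end Waveguide

theorem theorem3p1 (μ : MeasureTheory.Measure NNReal) [MeasureTheory.IsProbabilityMeasure μ]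
    (hμ : Waveguide.IsSiteLaw μ) :
    ∃ c₄ : ℝ, 0 < c₄ ∧
      ∀ (l : ℝ) (g : ℝ → ℝ) (γ : ℝ), 1 ≤ l → Waveguide.IsBump l g → 34 < γ →
        ∃ N₁ : ℕ, ∀ N : ℕ, N₁ ≤ N →
          (Waveguide.couplingInterval μ l g γ N).Nonempty ∧
          ∀ κ ∈ Waveguide.couplingInterval μ l g γ N,
            MeasureTheory.Measure.infinitePi (fun _ : ℤ => μ)
                {ω : Waveguide.Config |
                  Waveguide.lowestEigenvalue l g κ ω N 0 - 1 ≤ (N : ℝ) ^ (-(1 / 2) : ℝ)} ≤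
              ENNReal.ofReal
                ((N : ℝ) ^ (1 - 1 / γ) * Real.exp (-c₄ * (N : ℝ) ^ (1 / γ))) := by
  have hm := hμ.mean_pos
  refine ⟨Waveguide.mean μ ^ 2 / 2, by positivity, fun l g γ hl1 hg hγ => ?_⟩
  have hl : 0 < l := by linarith
  have hγ0 : 0 < γ := by linarith
  have hs : 0 < √(Waveguide.c₂ l g) := Real.sqrt_pos.2 (hg.c₂_pos hl)
  refine Filter.eventually_atTop.1 ?_
  filter_upwards [Waveguide.eventually_couplingInterval_nonempty hl hg hγ μ,
    Waveguide.eventually_mul_rpow_le (Waveguide.c₃ l g)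
      (show 0 < 15 / (2 * γ) by positivity) one_pos,
    Waveguide.eventually_gap (γ := γ) hl (hg.integral_deriv_sq_pos hl) hm hs (by linarith),
    Filter.eventually_gt_atTop 0] with N hne hκle hgap hN0
  refine ⟨hne, fun κ hκ => ?_⟩
  have hN1 : (1 : ℝ) ≤ N := by exact_mod_cast hN0
  have hNp : (0 : ℝ) < N := by linarith
  set K := ⌈(N : ℝ) ^ (1 / γ)⌉₊ with hKdef
  have hK1 : (N : ℝ) ^ (1 / γ) ≤ K := Nat.le_ceil _
  have hyp : 0 < (N : ℝ) ^ (1 / γ) := Real.rpow_pos_of_pos hNp _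
  have hK0 : 0 < K := Nat.ceil_pos.2 hyp
  have hKN : K ≤ N := by
    refine Nat.ceil_le.2 ?_
    calc (N : ℝ) ^ (1 / γ) ≤ (N : ℝ) ^ (1 : ℝ) := by
          refine Real.rpow_le_rpow_of_exponent_le hN1 ?_
          rw [div_le_one hγ0]
          linarith
      _ = N := Real.rpow_one _
  have hκ0 : 0 < κ := lt_of_lt_of_le (by positivity) hκ.1
  refine (Waveguide.measure_bad_le hμ (N / K) K fun ω hω hgood hbad => ?_).trans
    (ENNReal.ofReal_le_ofReal ?_)
  · have h1 := Waveguide.le_lowestEigenvalue hl hg hκ0 (hκ.2.trans hκle) hω hK0 hKN hm hgood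
    have h2 := hgap κ hκ.1
    have h3 : Waveguide.lowestEigenvalue l g κ ω N 0 - 1 ≤ (N : ℝ) ^ (-(1 / 2) : ℝ) := hbad
    linarith
  · have hJ : ((N / K : ℕ) : ℝ) ≤ (N : ℝ) ^ (1 - 1 / γ) := by
      rw [Real.rpow_sub hNp, Real.rpow_one]
      calc ((N / K : ℕ) : ℝ) ≤ (N : ℝ) / K := Nat.cast_div_le
        _ ≤ _ := by gcongr
    gcongr ?_ * Real.exp ?_
    rw [neg_mul, neg_mul]
    gcongr
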